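/- Let $X=\bigsqcup_{n\ge 1}X_n$ be a graded alphabet in which every $X_n$ is infinite; write $|x|=n$ for $x\in X_n$. Let $Sh(X)$ be the $\mathbf{Q}$-vector space with the words over $X$ as a basis (the empty word is $1$), graded by the weight $|y_1\dots y_k|=\sum_i|y_i|$, with the deconcatenation coproduct $\Delta(y_1\dots y_k)=\sum_{0\le i\le k}y_1\dots y_i\otimes y_{i+1}\dots y_k$ and the half-shuffle products $\prec,\succ$, determined by $(y_1u)\prec v=y_1(u ⧢ v)$ for a letter $y_1$ and words $u,v$ (where $⧢$ is the shuffle product), $1\prec v=0$ for every word $v$, and $x\succ y=y\prec x$. Equip $\mathrm{End}(Sh(X))$ with the half-products $f\prec g={\prec}\circ(f\otimes g)\circ\Delta$ and $f\succ g={\succ}\circ(f\otimes g)\circ\Delta$. Let $p_n$ be the projection of $Sh(X)$ onto the span of the words of weight $n$ that kills the words of other weights, and for $n\ge1$ let $\pi_n$ be the projection onto the span of the letters of weight $n$ that kills all other words. Let $\mathbf{S}$ be the vector space with basis the graded permutations (biwords) $(\sigma,d)$, $\sigma\in\mathfrak{S}_k$, $d:\{1,\dots,k\}\to\mathbf{N}^*$,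 $k\ge0$, regarded as a subspace of $\mathrm{End}(Sh(X))$: $(\sigma,d)$ maps $x_1\dots x_l$ to $x_{\sigma(1)}\dots x_{\sigma(k)}$ if $l=k$ and $|x_{\sigma(i)}|=d(i)$ for all $i$, and to $0$ otherwise. Let $\mathbf{S}_+$ be the span of the $(\sigma,d)$ with $k\ge1$. On $\mathbf{S}_+$, let $\Delta_\prec(\sigma,d)$ (resp. $\Delta_\succ(\sigma,d)$) be the sum, over the cuts of the biword into two nonempty parts such that the letter $1$ of the line $\sigma(1)\dots\sigma(k)$ is in the left (resp. right) part, of the tensor product of the two parts with their first lines standardized. Let $\mathbf{Descd}\subseteq\mathbf{S}$ be the smallest subspace of $\mathrm{End}(Sh(X))$ that contains all $p_n$, $n\ge0$, and is stable under $\prec$ and $\succ$, and let $\mathbf{Descd}_+=\mathbf{Descd}\cap\mathbf{S}_+=\{f\in\mathbf{Descd}: f(1)=0\}$. The dendriform primitive elements of $\mathbf{Descd}$ are the elements of $\mathbf{Descd}\cap\mathbf{S}_+$ killed by both $\Delta_\prec$ and $\Delta_\succ$. Then the family $(\pi_n)_{n\ge1}$ is a basis of the space of dendriform primitive elements of $\mathbf{Descd}$,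 and it freely generates $\mathbf{Descd}$ as a (unital) dendriform algebra: $\mathbf{Descd}=\mathbf{Q}\,p_0\oplus\mathbf{Descd}_+$, and $(\mathbf{Descd}_+,\prec,\succ)$ is a dendriform algebra over $\mathbf{Q}$, i.e. with $x*y=x\prec y+x\succ y$ it satisfies $$x\prec(y*z)=(x\prec y)\prec z,\qquad (x*y)\succ z=x\succ(y\succ z),\qquad (x\succ y)\prec z=x\succ(y\prec z),$$ which contains every $\pi_n$, and for every dendriform algebra $D$ over $\mathbf{Q}$ and every family $(a_n)_{n\ge1}$ in $D$ there is a unique morphism of dendriform algebras $\varphi:\mathbf{Descd}_+\to D$ with $\varphi(\pi_n)=a_n$ for all $n\ge1$. -/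

import Mathlib

open scoped TensorProduct

universe u w

namespace ShuffleDescent

/-! ### The shuffle bialgebra of a graded alphabet

A graded alphabet is a type `X` with a weight `wt : X → ℕ+`.  The space `Sh X` has the words over `X`
as a basis; the empty word `[]` is the unit. -/

abbrev Sh (X : Type*) := List X →₀ ℚ

/-- The weight of a word is the sum of the weights of its letters. -/
def weight {X : Type*} (wt : X → ℕ+) (w : List X) : ℕ := (w.map fun x => (wt x : ℕ)).sum

/-- The shuffle product of two words: its first letter is the first letter of one of the factors. -/
noncomputable def shuffleWord {X : Type*} : List X → List X → Sh X
  | [], v => Finsupp.single v 1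
  | a :: u, [] => Finsupp.single (a :: u) 1
  | a :: u, b :: v =>
      Finsupp.mapDomain (List.cons a) (shuffleWord u (b :: v)) +
        Finsupp.mapDomain (List.cons b) (shuffleWord (a :: u) v)
  termination_by u v => u.length + v.length

/-- The left half-shuffle of two words: `(a u) ≺ v = a (u ⧢ v)`, with the conventions
`w ≺ 1 = w` for a nonempty word `w` and `1 ≺ v = 0` for every word `v`. -/
noncomputable def precWord {X : Type*} : List X → List X → Sh X
  | [], _ => 0
  | a :: u, v => Finsupp.mapDomain (List.cons a) (shuffleWord u v)

/-- The left half-shuffle product on `Sh X`. -/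
noncomputable def shPrec (X : Type*) : Sh X →ₗ[ℚ] Sh X →ₗ[ℚ] Sh X :=
  Finsupp.linearCombination ℚ fun u => Finsupp.linearCombination ℚ fun v => precWord u v

/-- The right half-shuffle product on `Sh X`: `x ≻ y = y ≺ x`. -/
noncomputable def shSucc (X : Type*) : Sh X →ₗ[ℚ] Sh X →ₗ[ℚ] Sh X := (shPrec X).flip

/-- The deconcatenation coproduct. -/
noncomputable def deconc (X : Type*) : Sh X →ₗ[ℚ] Sh X ⊗[ℚ] Sh X :=
  Finsupp.linearCombination ℚ fun w =>
    ∑ k ∈ Finset.range (w.length + 1),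
      (Finsupp.single (w.take k) 1 : Sh X) ⊗ₜ[ℚ] (Finsupp.single (w.drop k) 1 : Sh X)

abbrev EndSh (X : Type*) := Sh X →ₗ[ℚ] Sh X

/-- For a bilinear product `m` on `Sh X`, the product `(f, g) ↦ m ∘ (f ⊗ g) ∘ Δ` on `End (Sh X)`. -/
noncomputable def conv {X : Type*} (m : Sh X →ₗ[ℚ] Sh X →ₗ[ℚ] Sh X) :
    EndSh X →ₗ[ℚ] EndSh X →ₗ[ℚ] EndSh X :=
  LinearMap.mk₂ ℚ (fun f g => TensorProduct.lift m ∘ₗ TensorProduct.map f g ∘ₗ deconc X)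
    (fun f f' g => by
      rw [TensorProduct.map_add_left, LinearMap.add_comp, LinearMap.comp_add])
    (fun c f g => by
      rw [TensorProduct.map_smul_left, LinearMap.smul_comp, LinearMap.comp_smul])
    (fun f g g' => by
      rw [TensorProduct.map_add_right, LinearMap.add_comp, LinearMap.comp_add])
    (fun c f g => by
      rw [TensorProduct.map_smul_right, LinearMap.smul_comp, LinearMap.comp_smul])

/-- The half-product `f ≺ g` on `End (Sh X)`. -/
noncomputable def endPrec (X : Type*) : EndSh X →ₗ[ℚ] EndSh X →ₗ[ℚ] EndSh X := conv (shPrec X)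

/-- The half-product `f ≻ g` on `End (Sh X)`. -/
noncomputable def endSucc (X : Type*) : EndSh X →ₗ[ℚ] EndSh X →ₗ[ℚ] EndSh X := conv (shSucc X)

/-- The graded projection `p n` of `Sh X` onto the span of the words of weight `n`. -/
noncomputable def p {X : Type*} (wt : X → ℕ+) (n : ℕ) : EndSh X :=
  Finsupp.linearCombination ℚ fun w => if weight wt w = n then Finsupp.single w 1 else 0

/-- The projection `π n` of `Sh X` onto the span of the letters of weight `n`, which
kills all other words. -/
noncomputable def letterProj {X : Type*} (wt : X → ℕ+) (n : ℕ+) : EndSh X :=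
  Finsupp.linearCombination ℚ fun w =>
    if w.length = 1 ∧ weight wt w = (n : ℕ) then Finsupp.single w 1 else 0

/-! ### Graded permutations -/

/-- A graded permutation `(σ, d)`, `σ` a permutation of `k` points and `d` a `k`-tuple of positive
integers; it is written as the biword with lines `σ(1) … σ(k)` and `d(1) … d(k)`.  The points
`1, …, k` are here the elements `0, …, k - 1` of `Fin k`. -/
abbrev GradedPerm := Σ k : ℕ, Equiv.Perm (Fin k) × (Fin k → ℕ+)

/-- The space `S` with the graded permutations as a basis. -/
abbrev GradedPermSpace := GradedPerm →₀ ℚ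

/-- The action of `(σ, d)` on words: `x₁ … x_l` is sent to `x_{σ(1)} … x_{σ(k)}` if `l = k` and
`x_{σ(i)}` has weight `d(i)` for every `i`, and to `0` otherwise. -/
noncomputable def actWord {X : Type*} (wt : X → ℕ+) (s : GradedPerm) (w : List X) : Sh X :=
  if h : s.1 = w.length then
    if ∀ i, wt (w.get (Fin.cast h (s.2.1 i))) = s.2.2 i then
      Finsupp.single (List.ofFn fun i => w.get (Fin.cast h (s.2.1 i))) 1
    else 0
  else 0

/-- The linear map `Φ : S → End (Sh X)`, through which `S` is regarded as a subspace of
`End (Sh X)` (it is injective when there are infinitely many letters of every weight). -/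
noncomputable def Phi {X : Type*} (wt : X → ℕ+) : GradedPermSpace →ₗ[ℚ] EndSh X :=
  Finsupp.linearCombination ℚ fun s => Finsupp.linearCombination ℚ (actWord wt s)

/-- The standardization of a word with distinct letters: the permutation with the same relative
order.  (`Tuple.sort f` is the permutation for which `f ∘ Tuple.sort f` is increasing.) -/
def standardize {k m : ℕ} (f : Fin k → Fin m) : Equiv.Perm (Fin k) := (Tuple.sort f).symm

/-- The standardization of the first `j` biletters of a biword. -/
def cutLeft (s : GradedPerm) (j : Fin s.1) : GradedPerm :=
  ⟨j, standardize fun i : Fin j => s.2.1 (i.castLE j.isLt.le),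
    fun i => s.2.2 (i.castLE j.isLt.le)⟩

/-- The standardization of what remains of a biword without its first `j` biletters. -/
def cutRight (s : GradedPerm) (j : Fin s.1) : GradedPerm :=
  ⟨s.1 - j, standardize fun i : Fin (s.1 - j) => s.2.1 ⟨j + i, by omega⟩,
    fun i => s.2.2 ⟨j + i, by omega⟩⟩

/-- The smallest letter of the first line is among the first `j` letters. -/
def MinInLeft (s : GradedPerm) (j : Fin s.1) : Prop := ∃ i : Fin s.1, i < j ∧ (s.2.1 i : ℕ) = 0

open Classical in
/-- The coproduct `Δ_≺` (extended by `0` to the empty biword): the sum over the cuts into two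
nonempty parts for which the smallest letter is in the left part. -/
noncomputable def deltaPrec : GradedPermSpace →ₗ[ℚ] GradedPermSpace ⊗[ℚ] GradedPermSpace :=
  Finsupp.linearCombination ℚ fun s => ∑ j : Fin s.1,
    if 0 < (j : ℕ) ∧ MinInLeft s j then
      (Finsupp.single (cutLeft s j) 1 : GradedPermSpace) ⊗ₜ[ℚ]
        (Finsupp.single (cutRight s j) 1 : GradedPermSpace)
    else 0

open Classical in
/-- The coproduct `Δ_≻` (extended by `0` to the empty biword): the sum over the cuts into two
nonempty parts for which the smallest letter is in the right part. -/
noncomputable def deltaSucc : GradedPermSpace →ₗ[ℚ] GradedPermSpace ⊗[ℚ] GradedPermSpace :=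
  Finsupp.linearCombination ℚ fun s => ∑ j : Fin s.1,
    if 0 < (j : ℕ) ∧ ¬ MinInLeft s j then
      (Finsupp.single (cutLeft s j) 1 : GradedPermSpace) ⊗ₜ[ℚ]
        (Finsupp.single (cutRight s j) 1 : GradedPermSpace)
    else 0

/-- The augmentation ideal `S₊`, spanned by the nonempty biwords. -/
noncomputable def augIdeal : Submodule ℚ GradedPermSpace := Finsupp.supported ℚ ℚ {s | 0 < s.1}

/-- The space of dendriform primitive elements of `S`. -/
noncomputable def primDend : Submodule ℚ GradedPermSpace :=
  augIdeal ⊓ LinearMap.ker deltaPrec ⊓ LinearMap.ker deltaSucc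

/-! ### The dendriform descent algebra -/

/-- `Descd`: the smallest subspace of `End (Sh X)` that contains the graded projections `p n`,
`n ≥ 0`, and is stable under both half-products. -/
noncomputable def descd {X : Type*} (wt : X → ℕ+) : Submodule ℚ (EndSh X) :=
  sInf {A | (∀ n, p wt n ∈ A) ∧
    ∀ f ∈ A, ∀ g ∈ A, endPrec X f g ∈ A ∧ endSucc X f g ∈ A}

/-- The augmentation ideal of `Descd`: its elements that kill the unit of `Sh X`. -/
noncomputable def descdPlus {X : Type*} (wt : X → ℕ+) : Submodule ℚ (EndSh X) :=
  descd wt ⊓ LinearMap.ker (LinearMap.applyₗ (R := ℚ) (M₂ := Sh X) (Finsupp.single ([] : List X) (1 : ℚ)))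

/-- The dendriform primitive elements of `Descd`, as a subspace of `End (Sh X)`. -/
noncomputable def primDescd {X : Type*} (wt : X → ℕ+) : Submodule ℚ (EndSh X) :=
  descd wt ⊓ primDend.map (Phi wt)

theorem descd_closed {X : Type*} (wt : X → ℕ+) {f g : EndSh X} (hf : f ∈ descd wt)
    (hg : g ∈ descd wt) : endPrec X f g ∈ descd wt ∧ endSucc X f g ∈ descd wt := by
  simp only [descd, Submodule.mem_sInf] at hf hg ⊢
  exact ⟨fun A hA => (hA.2 f (hf A hA) g (hg A hA)).1,
    fun A hA => (hA.2 f (hf A hA) g (hg A hA)).2⟩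

theorem conv_apply_nil {X : Type*} (m : Sh X →ₗ[ℚ] Sh X →ₗ[ℚ] Sh X) (f g : EndSh X)
    (hf : f (Finsupp.single [] 1) = 0) : conv m f g (Finsupp.single [] 1) = 0 := by
  simp [conv, deconc, hf]

theorem endPrec_mem_descdPlus {X : Type*} (wt : X → ℕ+) (f g : EndSh X)
    (hf : f ∈ descdPlus wt) (hg : g ∈ descdPlus wt) : endPrec X f g ∈ descdPlus wt :=
  ⟨(descd_closed wt hf.1 hg.1).1, conv_apply_nil _ f g hf.2⟩

theorem endSucc_mem_descdPlus {X : Type*} (wt : X → ℕ+) (f g : EndSh X)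
    (hf : f ∈ descdPlus wt) (hg : g ∈ descdPlus wt) : endSucc X f g ∈ descdPlus wt :=
  ⟨(descd_closed wt hf.1 hg.1).2, conv_apply_nil _ f g hf.2⟩

/-- The restriction of a bilinear product to a subspace that is stable under it. -/
def restrictProduct {V : Type*} [AddCommGroup V] [Module ℚ V] (m : V →ₗ[ℚ] V →ₗ[ℚ] V)
    (A : Submodule ℚ V) (h : ∀ x y, x ∈ A → y ∈ A → m x y ∈ A) : A →ₗ[ℚ] A →ₗ[ℚ] A :=
  LinearMap.mk₂ ℚ (fun x y => ⟨m x y, h x y x.2 y.2⟩)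
    (fun x x' y => Subtype.ext (by simp))
    (fun c x y => Subtype.ext (by simp))
    (fun x y y' => Subtype.ext (by simp))
    (fun c x y => Subtype.ext (by simp))

/-- The half-product `≺` of the augmentation ideal of `Descd`. -/
noncomputable def descdPrec {X : Type*} (wt : X → ℕ+) :
    descdPlus wt →ₗ[ℚ] descdPlus wt →ₗ[ℚ] descdPlus wt :=
  restrictProduct (endPrec X) (descdPlus wt) (endPrec_mem_descdPlus wt)

/-- The half-product `≻` of the augmentation ideal of `Descd`. -/
noncomputable def descdSucc {X : Type*} (wt : X → ℕ+) :
    descdPlus wt →ₗ[ℚ] descdPlus wt →ₗ[ℚ] descdPlus wt :=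
  restrictProduct (endSucc X) (descdPlus wt) (endSucc_mem_descdPlus wt)

/-! ### Dendriform algebras -/

/-- The bilinear products `l` (for `≺`) and `r` (for `≻`) make `V` a dendriform algebra (without
unit) over `ℚ`; the associative product is `x * y = x ≺ y + x ≻ y`. -/
structure IsDendriform {V : Type*} [AddCommGroup V] [Module ℚ V]
    (l r : V →ₗ[ℚ] V →ₗ[ℚ] V) : Prop where
  prec_star : ∀ x y z, l x (l y z + r y z) = l (l x y) z
  star_succ : ∀ x y z, r (l x y + r x y) z = r x (r y z)
  succ_prec : ∀ x y z, l (r x y) z = r x (l y z)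

/-- `V`, with the products `l` and `r`, is a dendriform algebra, freely generated by the family `g`:
every map of the index set to a dendriform algebra `D` (in the universe `w0`) extends uniquely to a
morphism of dendriform algebras. -/
def IsFreeDendriform.{v, i, w0} {V : Type v} [AddCommGroup V] [Module ℚ V]
    (l r : V →ₗ[ℚ] V →ₗ[ℚ] V) {ι : Type i} (g : ι → V) : Prop :=
  IsDendriform l r ∧
    ∀ (D : Type w0) [AddCommGroup D] [Module ℚ D] (l' r' : D →ₗ[ℚ] D →ₗ[ℚ] D),
      IsDendriform l' r' → ∀ a : ι → D,
        ∃! φ : V →ₗ[ℚ] D, (∀ x y, φ (l x y) = l' (φ x) (φ y)) ∧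
          (∀ x y, φ (r x y) = r' (φ x) (φ y)) ∧ ∀ n, φ (g n) = a n

end ShuffleDescent

/-!
The letter projections are obtained from the projections `p n`, and conversely, because a nonempty
word is its first letter followed by a word: `p_{n+1} = ∑ π_{i+1} ≺ p_{n-i}` (`p_succ`).  So
`Descd` is spanned by the unit `p 0` and by the dendriform algebra that the `π n` generate
(`descdPlus_le`).  The dendriform identities reduce, by coassociativity of deconcatenation, to
`(x ≺ y) ≺ z = x ≺ (y ⧢ z)` in `Sh X` (`shPrec_shPrec`).

Freeness.  In a dendriform algebra, a binary tree whose nodes are decorated by generators is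
evaluated recursively as `s ≻ (g n ≺ t)`, with `n` the root and `s`, `t` the subtrees.  The
half-products of two evaluations are combinations of evaluations, with coefficients that do not
depend on the algebra (`treeEvalLin_treePrec`, `treeEvalLin_treeSucc`).  Hence the evaluations of the
nonempty trees span the algebra generated by the family, and if they are linearly independent this
algebra is free (`isFreeDendriform_of_basis`).  In `Descd`, the evaluation of a tree sends a word to
the sum of the words obtained by listing its letters along the linear extensions of the tree, where
the letters label the nodes in infix order (`treeEnd`).  Label the nodes of a tree by distinct
letters of the right weights, which is possible since every weight has infinitely many letters; let
`w` be the infix word and `z` a prefix word.  Then `z` occurs in the image of `w` under this tree and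
under no other one (`treeEnd_inorder_preorderRight`), so the evaluations are linearly independent.

Primitive elements.  The half-coproducts of graded permutations are adjoint to the half-shuffles: a
dendriform primitive element `f` satisfies `⟨f (A ≺ B), a b⟩ = ⟨f (B ≺ A), a b⟩ = 0` whenever `A`
and `B` are nonempty words without a common letter, and `a`, `b` are anagrams of `A`, `B`
(`Phi_precWord_apply_eq_zero`).  Expand `f` in the basis of trees.  Taking for `A` the root alone,
the first equation shows that the coefficient of a tree with an empty left subtree and a nonempty
right one vanishes.  In any other tree that is not a single node, the leftmost node `v` is not the
root.  Let `B = v c` consist of `v` and the nodes of its right subtree, and `A` of the other nodes.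
By the second equation the coefficient of the tree is, up to sign, a sum of coefficients of trees
where the right subtree of the leftmost node is smaller, and it vanishes by induction
(`coeff_eq_zero_of_left_ne_nil`).  Only the trees with a single node are left, and these are the
letter projections.
-/

namespace ShuffleDescent

open BinaryTree

/-! ### The shuffle product and the half-shuffles -/

section Shuffle

variable {X : Type*}

theorem Sh.induction {motive : Sh X → Prop} (zero : motive 0)
    (add : ∀ x y, motive x → motive y → motive (x + y))
    (smul : ∀ (c : ℚ) x, motive x → motive (c • x))
    (word : ∀ w, motive (Finsupp.single w 1)) (x : Sh X) : motive x := by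
  induction x using Finsupp.induction_linear with
  | zero => exact zero
  | add f g hf hg => exact add f g hf hg
  | single w c =>
    have := smul c _ (word w)
    rwa [Finsupp.smul_single, smul_eq_mul, mul_one] at this

/-- Left concatenation with a letter. -/
noncomputable def consMap (a : X) : Sh X →ₗ[ℚ] Sh X := Finsupp.lmapDomain ℚ ℚ (List.cons a)

@[simp] theorem consMap_single (a : X) (w : List X) (c : ℚ) :
    consMap a (Finsupp.single w c) = Finsupp.single (a :: w) c := by
  simp [consMap]

@[simp] theorem consMap_apply_nil (a : X) (x : Sh X) : consMap a x [] = 0 :=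
  Finsupp.mapDomain_of_notMem_range _ _ (by simp)

@[simp] theorem consMap_apply_cons_self (a : X) (x : Sh X) (w : List X) :
    consMap a x (a :: w) = x w :=
  Finsupp.mapDomain_apply (List.cons_injective) _ _

theorem consMap_apply_cons_of_ne {a b : X} (h : b ≠ a) (x : Sh X) (w : List X) :
    consMap a x (b :: w) = 0 :=
  Finsupp.mapDomain_of_notMem_range _ _ (by simp [h.symm])

/-- The shuffle product on `Sh X`. -/
noncomputable def shuffle (X : Type*) : Sh X →ₗ[ℚ] Sh X →ₗ[ℚ] Sh X :=
  Finsupp.linearCombination ℚ fun u => Finsupp.linearCombination ℚ fun v => shuffleWord u v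

@[simp] theorem shuffle_single_single (u v : List X) :
    shuffle X (Finsupp.single u 1) (Finsupp.single v 1) = shuffleWord u v := by
  simp [shuffle]

@[simp] theorem shPrec_single_single (u v : List X) :
    shPrec X (Finsupp.single u 1) (Finsupp.single v 1) = precWord u v := by
  simp [shPrec]

@[simp] theorem shuffleWord_nil_left (v : List X) : shuffleWord [] v = Finsupp.single v 1 := by
  rw [shuffleWord]

@[simp] theorem shuffleWord_nil_right (v : List X) : shuffleWord v [] = Finsupp.single v 1 := by
  cases v <;> rw [shuffleWord]

theorem shuffleWord_cons_cons (a b : X) (u v : List X) :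
    shuffleWord (a :: u) (b :: v) =
      consMap a (shuffleWord u (b :: v)) + consMap b (shuffleWord (a :: u) v) := by
  rw [shuffleWord]; rfl

@[simp] theorem precWord_nil_left (v : List X) : precWord [] v = 0 := rfl

theorem precWord_cons (a : X) (u v : List X) :
    precWord (a :: u) v = consMap a (shuffleWord u v) := rfl

@[simp] theorem shPrec_unit_left (y : Sh X) : shPrec X (Finsupp.single [] 1) y = 0 := by
  induction y using Sh.induction <;> simp_all

theorem shPrec_consMap (a : X) (x y : Sh X) :
    shPrec X (consMap a x) y = consMap a (shuffle X x y) := by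
  induction x using Sh.induction with
  | zero => simp
  | add x x' h h' => simp [h, h']
  | smul c x h => simp [h]
  | word u =>
    induction y using Sh.induction with
    | zero => simp
    | add x x' h h' => simp only [map_add, h, h']
    | smul c x h => simp only [map_smul, h]
    | word v => simp [precWord_cons]

theorem shPrec_unit_right {x : Sh X} (hx : x [] = 0) : shPrec X x (Finsupp.single [] 1) = x := by
  have key : ∀ y : Sh X, shPrec X y (Finsupp.single [] 1) + y [] • Finsupp.single [] 1 = y := by
    intro y
    induction y using Sh.induction with
    | zero => simp
    | add x y hx hy =>
      conv_rhs => rw [← hx, ← hy]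
      rw [Finsupp.add_apply, map_add, LinearMap.add_apply, add_smul]
      abel
    | smul c x hx =>
      conv_rhs => rw [← hx]
      rw [Finsupp.smul_apply, map_smul, LinearMap.smul_apply, smul_add, smul_smul, smul_eq_mul]
    | word w => cases w <;> simp [precWord_cons]
  simpa [hx] using key x

theorem shuffleWord_comm (u v : List X) : shuffleWord u v = shuffleWord v u := by
  induction u, v using shuffleWord.induct with
  | case1 => simp
  | case2 => simp
  | case3 a u b v h h' => rw [shuffleWord_cons_cons, shuffleWord_cons_cons, h, h', add_comm]

theorem shuffleWord_eq_precWord_add (u v : List X) :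
    shuffleWord u v = precWord u v + precWord v u +
      ((Finsupp.single u 1 : Sh X) [] * (Finsupp.single v 1 : Sh X) []) • Finsupp.single [] 1 := by
  cases u <;> cases v <;> simp [precWord_cons, shuffleWord_cons_cons, shuffleWord_comm]

theorem shuffle_eq_shPrec_add (x y : Sh X) :
    shuffle X x y = shPrec X x y + shPrec X y x + (x [] * y []) • Finsupp.single [] 1 := by
  induction x using Sh.induction with
  | zero => simp
  | add x x' h h' =>
    rw [map_add, LinearMap.add_apply, h, h', Finsupp.add_apply, add_mul, add_smul, map_add,
      map_add, LinearMap.add_apply]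
    abel
  | smul c x h =>
    rw [map_smul, LinearMap.smul_apply, h, Finsupp.smul_apply, smul_eq_mul, mul_assoc, mul_smul c,
      map_smul, map_smul, LinearMap.smul_apply, smul_add, smul_add]
  | word u =>
    induction y using Sh.induction with
    | zero => simp
    | add x x' h h' =>
      rw [map_add, h, h', Finsupp.add_apply, mul_add, add_smul, map_add,
        map_add, LinearMap.add_apply]
      abel
    | smul c x h =>
      rw [map_smul, h, Finsupp.smul_apply, smul_eq_mul, mul_left_comm, mul_smul c,
        map_smul, map_smul, LinearMap.smul_apply, smul_add, smul_add]
    | word v =>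
      rw [shuffle_single_single, shPrec_single_single, shPrec_single_single,
        shuffleWord_eq_precWord_add]

theorem shuffle_comm (x y : Sh X) : shuffle X x y = shuffle X y x := by
  rw [shuffle_eq_shPrec_add, shuffle_eq_shPrec_add, add_comm (shPrec X x y), mul_comm]

/-- If none of the three words is empty, both sides are the sum of the words that start with the
first letter of `u`, of `v` and of `w`; each of these three parts is a triple shuffle of shorter
words. -/
theorem shuffle_assoc_word (u v w : List X) :
    shuffle X (shuffleWord u v) (Finsupp.single w 1) =
      shuffle X (Finsupp.single u 1) (shuffleWord v w) := by
  have nil_left : ∀ y : Sh X, shuffle X (Finsupp.single [] 1) y = y := by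
    intro y
    induction y using Sh.induction <;> simp_all
  induction hn : u.length + v.length + w.length using Nat.strong_induction_on
    generalizing u v w with
  | _ n ih =>
  rcases u with _ | ⟨a, u⟩
  · simp [nil_left]
  rcases v with _ | ⟨b, v⟩
  · simp
  rcases w with _ | ⟨c, w⟩
  · rw [shuffle_comm, nil_left]; simp
  have key : ∀ (a : X) (u v w : List X), u.length + v.length + w.length < n →
      shPrec X (precWord (a :: u) v) (Finsupp.single w 1) =
        shPrec X (Finsupp.single (a :: u) 1) (shuffleWord v w) := by
    intro a u v w h
    rw [precWord_cons, shPrec_consMap, ih _ h u v w rfl, ← shPrec_consMap, consMap_single]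
  simp only [List.length_cons] at hn
  have e1 := key a u (b :: v) (c :: w) (by simp; omega)
  have e2 := key b v (a :: u) (c :: w) (by simp; omega)
  have e3 := key b v (c :: w) (a :: u) (by simp; omega)
  have e4 := key c w (b :: v) (a :: u) (by simp; omega)
  have split : ∀ (a : X) (u : List X) (b : X) (v : List X), shuffleWord (a :: u) (b :: v) =
      precWord (a :: u) (b :: v) + precWord (b :: v) (a :: u) := by
    intro a u b v
    rw [shuffleWord_eq_precWord_add]; simp
  have nil : ∀ (a : X) (u : List X) (b : X) (v : List X), shuffleWord (a :: u) (b :: v) [] = 0 := by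
    intro a u b v
    simp [shuffleWord_cons_cons]
  have left : shPrec X (shuffleWord (a :: u) (b :: v)) (Finsupp.single (c :: w) 1) =
      shPrec X (Finsupp.single (a :: u) 1) (shuffleWord (b :: v) (c :: w)) +
        shPrec X (Finsupp.single (b :: v) 1) (shuffleWord (a :: u) (c :: w)) := by
    rw [split, map_add, LinearMap.add_apply, e1, e2]
  have right : shPrec X (shuffleWord (b :: v) (c :: w)) (Finsupp.single (a :: u) 1) =
      shPrec X (Finsupp.single (b :: v) 1) (shuffleWord (c :: w) (a :: u)) +
        shPrec X (Finsupp.single (c :: w) 1) (shuffleWord (b :: v) (a :: u)) := by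
    rw [split, map_add, LinearMap.add_apply, e3, e4]
  rw [shuffle_eq_shPrec_add, shuffle_eq_shPrec_add, nil, nil, left, right,
    shuffleWord_comm (b :: v) (a :: u), shuffleWord_comm (c :: w) (a :: u)]
  simp only [zero_mul, mul_zero]
  abel

theorem shuffle_assoc (x y z : Sh X) :
    shuffle X (shuffle X x y) z = shuffle X x (shuffle X y z) := by
  induction x using Sh.induction with
  | zero => simp
  | add x x' h h' => simp [h, h']
  | smul c x h => simp [h]
  | word u =>
  induction y using Sh.induction with
  | zero => simp
  | add x x' h h' => simp only [map_add, LinearMap.add_apply, h, h']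
  | smul c x h => simp only [map_smul, LinearMap.smul_apply, h]
  | word v =>
  induction z using Sh.induction with
  | zero => simp
  | add x x' h h' => simp only [map_add, h, h']
  | smul c x h => simp only [map_smul, h]
  | word w => simp [shuffle_assoc_word]

theorem shPrec_shPrec (x y z : Sh X) :
    shPrec X (shPrec X x y) z = shPrec X x (shuffle X y z) := by
  induction x using Sh.induction with
  | zero => simp
  | add x x' h h' => simp [h, h']
  | smul c x h => simp [h]
  | word u =>
    cases u with
    | nil => simp
    | cons a u =>
      rw [← consMap_single, shPrec_consMap, shPrec_consMap, shPrec_consMap, shuffle_assoc]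

end Shuffle

/-! ### Convolution and deconcatenation -/

section Conv

variable {X : Type*} {M : Type*} [AddCommMonoid M]

/-- The sum of `G u v` over the factorizations `w = u v` of a word. -/
def cutSum (w : List X) (G : List X → List X → M) : M :=
  ∑ k ∈ Finset.range (w.length + 1), G (w.take k) (w.drop k)

@[simp] theorem cutSum_nil (G : List X → List X → M) : cutSum [] G = G [] [] := by
  simp [cutSum]

theorem cutSum_cons (a : X) (w : List X) (G : List X → List X → M) :
    cutSum (a :: w) G = G [] (a :: w) + cutSum w fun u v => G (a :: u) v := by
  rw [cutSum, List.length_cons, Finset.sum_range_succ', add_comm]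
  simp [cutSum]

theorem cutSum_add (w : List X) (G H : List X → List X → M) :
    cutSum w (fun u v => G u v + H u v) = cutSum w G + cutSum w H :=
  Finset.sum_add_distrib

/-- A sum over factorizations only depends on the summand at actual factorizations. -/
theorem cutSum_congr {w : List X} {G H : List X → List X → M}
    (h : ∀ u v, u ++ v = w → G u v = H u v) : cutSum w G = cutSum w H :=
  Finset.sum_congr rfl fun _ _ => h _ _ (List.take_append_drop _ _)

theorem cutSum_eq_zero {w : List X} {G : List X → List X → M}
    (h : ∀ u v, u ++ v = w → G u v = 0) : cutSum w G = 0 :=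
  Finset.sum_eq_zero fun _ _ => h _ _ (List.take_append_drop _ _)

theorem map_cutSum {N F : Type*} [AddCommMonoid N] [FunLike F M N] [AddMonoidHomClass F M N]
    (φ : F) (w : List X) (G : List X → List X → M) :
    φ (cutSum w G) = cutSum w fun u v => φ (G u v) :=
  map_sum φ _ _

/-- Coassociativity of deconcatenation. -/
theorem cutSum_cutSum (w : List X) (H : List X → List X → List X → M) :
    cutSum w (fun p v => cutSum p fun u x => H u x v) =
      cutSum w (fun u q => cutSum q fun x v => H u x v) := by
  induction w generalizing H with
  | nil => simp
  | cons a w ih => simp only [cutSum_cons, cutSum_nil, cutSum_add, ih, add_assoc]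

/-- If only one factorization contributes, namely the one in front of a prescribed letter which
occurs once, the sum reduces to this term. -/
theorem cutSum_eq_single {u v : List X} {y : X} (hn : (u ++ y :: v).Nodup)
    {G : List X → List X → M} (hnil : ∀ p, G p [] = 0)
    (hG : ∀ p z q, z ≠ y → G p (z :: q) = 0) :
    cutSum (u ++ y :: v) G = G u (y :: v) := by
  induction u generalizing G with
  | nil =>
    rw [List.nil_append, cutSum_cons, cutSum_eq_zero, add_zero]
    rintro p q rfl
    rcases q with _ | ⟨z, q⟩
    · exact hnil _
    · refine hG _ _ _ ?_
      rintro rfl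
      simp at hn
  | cons a u ih =>
    rw [List.cons_append, cutSum_cons, ih (List.nodup_cons.1 hn).2 (fun p => hnil _)
      (fun p z q hz => hG _ z q hz), hG, zero_add]
    rintro rfl
    simp at hn

theorem conv_single (m : Sh X →ₗ[ℚ] Sh X →ₗ[ℚ] Sh X) (f g : EndSh X) (w : List X) :
    conv m f g (Finsupp.single w 1) =
      cutSum w fun u v => m (f (Finsupp.single u 1)) (g (Finsupp.single v 1)) := by
  simp [conv, deconc, cutSum, map_sum]

theorem EndSh.ext_word {f g : EndSh X}
    (h : ∀ w, f (Finsupp.single w 1) = g (Finsupp.single w 1)) : f = g :=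
  Finsupp.lhom_ext fun w c => by
    have := congrArg (fun x => c • x) (h w)
    simpa only [← map_smul, Finsupp.smul_single, smul_eq_mul, mul_one] using this

theorem endPrec_single (f g : EndSh X) (w : List X) :
    endPrec X f g (Finsupp.single w 1) =
      cutSum w fun u v => shPrec X (f (Finsupp.single u 1)) (g (Finsupp.single v 1)) :=
  conv_single _ _ _ _

theorem endSucc_single (f g : EndSh X) (w : List X) :
    endSucc X f g (Finsupp.single w 1) =
      cutSum w fun u v => shPrec X (g (Finsupp.single v 1)) (f (Finsupp.single u 1)) :=
  conv_single _ _ _ _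

theorem shPrec_cutSum_left (w : List X) (G : List X → List X → Sh X) (y : Sh X) :
    shPrec X (cutSum w G) y = cutSum w fun u v => shPrec X (G u v) y :=
  map_cutSum ((shPrec X).flip y) w G

theorem shPrec_cutSum_right (w : List X) (G : List X → List X → Sh X) (y : Sh X) :
    shPrec X y (cutSum w G) = cutSum w fun u v => shPrec X y (G u v) :=
  map_cutSum (shPrec X y) w G

/-- If the values of `g` have no constant term, then `≺` and `≻` add up to the full shuffle
product in the inner product `g * h`. -/
theorem endPrec_endPrec {f g h : EndSh X} (hg : ∀ x, g x [] = 0) :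
    endPrec X f (endPrec X g h + endSucc X g h) = endPrec X (endPrec X f g) h := by
  refine EndSh.ext_word fun w => ?_
  simp only [endPrec_single, endSucc_single, LinearMap.add_apply, ← cutSum_add,
    shPrec_cutSum_left, shPrec_cutSum_right, cutSum_cutSum, shPrec_shPrec, shuffle_eq_shPrec_add,
    hg, zero_mul, zero_smul, add_zero]

theorem endSucc_endSucc {f g h : EndSh X} (hg : ∀ x, g x [] = 0) :
    endSucc X (endPrec X f g + endSucc X f g) h = endSucc X f (endSucc X g h) := by
  refine EndSh.ext_word fun w => ?_
  simp only [endPrec_single, endSucc_single, LinearMap.add_apply, ← cutSum_add,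
    shPrec_cutSum_left, shPrec_cutSum_right, cutSum_cutSum, shPrec_shPrec, shuffle_eq_shPrec_add,
    hg, zero_mul, zero_smul, zero_add, add_comm]

theorem endPrec_endSucc (f g h : EndSh X) :
    endPrec X (endSucc X f g) h = endSucc X f (endPrec X g h) := by
  refine EndSh.ext_word fun w => ?_
  simp only [endPrec_single, endSucc_single, shPrec_cutSum_left, cutSum_cutSum, shPrec_shPrec]
  exact cutSum_congr fun _ _ _ => cutSum_congr fun _ _ _ => by rw [shuffle_comm]

end Conv

/-! ### Support of the products -/

section Support

variable {X : Type*}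

theorem exists_of_linearCombination₂_apply_ne_zero {F : List X → List X → Sh X} {x y : Sh X}
    {z : List X} (h : Finsupp.linearCombination ℚ
      (fun u => Finsupp.linearCombination ℚ fun v => F u v) x y z ≠ 0) :
    ∃ u v, x u ≠ 0 ∧ y v ≠ 0 ∧ F u v z ≠ 0 := by
  rw [Finsupp.linearCombination_apply, Finsupp.sum, LinearMap.sum_apply, Finsupp.finsetSum_apply]
    at h
  obtain ⟨u, hu, h⟩ := Finset.exists_ne_zero_of_sum_ne_zero h
  rw [LinearMap.smul_apply, Finsupp.linearCombination_apply, Finsupp.sum, Finsupp.smul_apply,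
    Finsupp.finsetSum_apply, smul_eq_mul] at h
  obtain ⟨v, hv, h⟩ := Finset.exists_ne_zero_of_sum_ne_zero (right_ne_zero_of_mul h)
  exact ⟨u, v, Finsupp.mem_support_iff.1 hu, Finsupp.mem_support_iff.1 hv,
    right_ne_zero_of_mul h⟩

theorem exists_of_shPrec_apply_ne_zero {x y : Sh X} {z : List X} (h : shPrec X x y z ≠ 0) :
    ∃ u v, x u ≠ 0 ∧ y v ≠ 0 ∧ precWord u v z ≠ 0 :=
  exists_of_linearCombination₂_apply_ne_zero h

theorem exists_of_shuffle_apply_ne_zero {x y : Sh X} {z : List X} (h : shuffle X x y z ≠ 0) :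
    ∃ u v, x u ≠ 0 ∧ y v ≠ 0 ∧ shuffleWord u v z ≠ 0 :=
  exists_of_linearCombination₂_apply_ne_zero h

theorem exists_of_cutSum_apply_ne_zero {w z : List X} {G : List X → List X → Sh X}
    (h : cutSum w G z ≠ 0) : ∃ u v, u ++ v = w ∧ G u v z ≠ 0 := by
  by_contra! hG
  refine h ?_
  rw [← Finsupp.applyAddHom_apply, map_cutSum]
  exact cutSum_eq_zero hG

theorem exists_of_consMap_apply_ne_zero {a : X} {x : Sh X} {z : List X}
    (h : consMap a x z ≠ 0) : ∃ z', z = a :: z' ∧ x z' ≠ 0 := by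
  rcases z with _ | ⟨b, z⟩
  · simp at h
  by_cases hb : b = a
  · subst hb
    exact ⟨z, rfl, by simpa using h⟩
  · exact absurd (consMap_apply_cons_of_ne hb x z) h

open Classical in
/-- When the letters of `A` and of `B` are told apart by a predicate `P`, a word occurs in the
shuffle of `A` and `B`, and then once, exactly if `A` and `B` are its two parts with respect
to `P`. -/
theorem shuffleWord_apply (P : X → Prop) {A B : List X} (hA : ∀ a ∈ A, P a) (hB : ∀ b ∈ B, ¬ P b)
    (w : List X) : shuffleWord A B w =
      if w.filter (fun x => P x) = A ∧ w.filter (fun x => ¬ P x) = B then 1 else 0 := by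
  induction w generalizing A B with
  | nil => rcases A with _ | ⟨a, A⟩ <;> rcases B with _ | ⟨b, B⟩ <;>
      simp [shuffleWord_cons_cons]
  | cons x w ih =>
    have right : ∀ (b : X) (B : List X), (∀ b' ∈ b :: B, ¬ P b') → (x :: w = b :: B ↔
        (x :: w).filter (fun x => P x) = [] ∧ (x :: w).filter (fun x => ¬ P x) = b :: B) := by
      intro b B hB
      constructor
      · intro h
        rw [h, List.filter_eq_nil_iff, List.filter_eq_self]
        exact ⟨fun x hx => by simpa using hB x hx, fun x hx => by simpa using hB x hx⟩
      · rintro ⟨h1, h2⟩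
        rw [← h2, eq_comm, List.filter_eq_self]
        intro y hy
        have := List.filter_eq_nil_iff.1 h1 y hy
        simpa using this
    have left : ∀ (a : X) (A : List X), (∀ a' ∈ a :: A, P a') → (x :: w = a :: A ↔
        (x :: w).filter (fun x => P x) = a :: A ∧ (x :: w).filter (fun x => ¬ P x) = []) := by
      intro a A hA
      constructor
      · intro h
        rw [h, List.filter_eq_nil_iff, List.filter_eq_self]
        exact ⟨fun x hx => by simpa using hA x hx, fun x hx => by simpa using hA x hx⟩
      · rintro ⟨h1, h2⟩
        rw [← h1, eq_comm, List.filter_eq_self]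
        intro y hy
        have := List.filter_eq_nil_iff.1 h2 y hy
        simpa using this
    rcases A with _ | ⟨a, A⟩ <;> rcases B with _ | ⟨b, B⟩
    · by_cases hx : P x <;> simp [hx]
    · rw [shuffleWord_nil_left, Finsupp.single_apply]
      refine if_congr (eq_comm.trans (right b B hB)) rfl rfl
    · rw [shuffleWord_nil_right, Finsupp.single_apply]
      refine if_congr (eq_comm.trans (left a A hA)) rfl rfl
    · rw [shuffleWord_cons_cons, Finsupp.add_apply]
      have ha : P a := hA a (by simp)
      have hb : ¬ P b := hB b (by simp)
      by_cases hx : P x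
      · rw [consMap_apply_cons_of_ne (a := b) (fun e => hb (e ▸ hx)), add_zero]
        by_cases hxa : x = a
        · subst hxa
          rw [consMap_apply_cons_self, ih (fun y hy => hA y (by simp [hy])) hB]
          simp [hx]
        · rw [consMap_apply_cons_of_ne hxa]
          simp [hx, hxa]
      · rw [consMap_apply_cons_of_ne (a := a) (b := x) (fun e => hx (e ▸ ha)), zero_add]
        by_cases hxb : x = b
        · subst hxb
          rw [consMap_apply_cons_self, ih hA (fun y hy => hB y (by simp [hy]))]
          simp [hx]
        · rw [consMap_apply_cons_of_ne hxb]
          simp [hx, hxb]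

open Classical in
theorem precWord_apply (P : X → Prop) {A B : List X} (hA : ∀ a ∈ A, P a) (hB : ∀ b ∈ B, ¬ P b)
    (x : X) (w : List X) : precWord A B (x :: w) =
      if P x ∧ (x :: w).filter (fun x => P x) = A ∧ (x :: w).filter (fun x => ¬ P x) = B
      then 1 else 0 := by
  rcases A with _ | ⟨a, A⟩
  · by_cases hx : P x <;> simp [hx]
  · rw [precWord_cons]
    have ha : P a := hA a (by simp)
    by_cases hxa : x = a
    · subst hxa
      rw [consMap_apply_cons_self, shuffleWord_apply P (fun y hy => hA y (by simp [hy])) hB]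
      simp [ha]
    · rw [consMap_apply_cons_of_ne hxa]
      by_cases hx : P x <;> simp [hx, hxa]

theorem perm_of_shuffleWord_apply_ne_zero {u v z : List X} (h : shuffleWord u v z ≠ 0) :
    z.Perm (u ++ v) := by
  induction u, v using shuffleWord.induct generalizing z with
  | case1 v =>
    rw [shuffleWord_nil_left, Finsupp.single_apply_ne_zero] at h
    simp [h.1]
  | case2 a u =>
    rw [shuffleWord_nil_right, Finsupp.single_apply_ne_zero] at h
    simp [h.1]
  | case3 a u b v ih ih' =>
    rw [shuffleWord_cons_cons, Finsupp.add_apply] at h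
    by_cases h1 : consMap a (shuffleWord u (b :: v)) z = 0
    · rw [h1, zero_add] at h
      obtain ⟨z, rfl, h'⟩ := exists_of_consMap_apply_ne_zero h
      exact ((ih' h').cons b).trans List.perm_middle.symm
    · obtain ⟨z, rfl, h'⟩ := exists_of_consMap_apply_ne_zero h1
      exact (ih h').cons a

theorem perm_of_precWord_apply_ne_zero {u v z : List X} (h : precWord u v z ≠ 0) :
    z.Perm (u ++ v) := by
  rcases u with _ | ⟨a, u⟩
  · simp at h
  · obtain ⟨z, rfl, h'⟩ := exists_of_consMap_apply_ne_zero h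
    exact (perm_of_shuffleWord_apply_ne_zero h').cons a

end Support

/-! ### The descent algebra and its generators -/

section Descd

variable {X : Type*} (wt : X → ℕ+)

/-- The endomorphisms that send every word to a combination of its anagrams. -/
def anagramEnd (X : Type*) : Submodule ℚ (EndSh X) where
  carrier := {f | ∀ w z, f (Finsupp.single w 1) z ≠ 0 → z.Perm w}
  zero_mem' := by simp
  add_mem' {f g} hf hg w z h := by
    by_cases h1 : f (Finsupp.single w 1) z = 0
    · refine hg w z fun h2 => h ?_
      simp [h1, h2]
    · exact hf w z h1
  smul_mem' c f hf w z h := hf w z fun h1 => h (by simp [h1])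

theorem p_single (n : ℕ) (w : List X) :
    p wt n (Finsupp.single w 1) = if weight wt w = n then Finsupp.single w 1 else 0 := by
  simp [p]

theorem letterProj_single (n : ℕ+) (w : List X) : letterProj wt n (Finsupp.single w 1) =
    if w.length = 1 ∧ weight wt w = (n : ℕ) then Finsupp.single w 1 else 0 := by
  simp [letterProj]

@[simp] theorem weight_nil : weight wt [] = 0 := rfl

@[simp] theorem weight_cons (a : X) (w : List X) : weight wt (a :: w) = wt a + weight wt w := by
  simp [weight]

theorem p_zero_cons (a : X) (w : List X) : p wt 0 (Finsupp.single (a :: w) 1) = 0 := by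
  rw [p_single, if_neg]
  simp

theorem p_zero_nil : p wt 0 (Finsupp.single [] 1) = Finsupp.single [] 1 := by
  simp [p_single]

theorem letterProj_nil (n : ℕ+) : letterProj wt n (Finsupp.single [] 1) = 0 := by
  simp [letterProj_single]

theorem letterProj_cons (n : ℕ+) (a : X) (w : List X) :
    letterProj wt n (Finsupp.single (a :: w) 1) =
      if w = [] ∧ wt a = n then Finsupp.single [a] 1 else 0 := by
  rw [letterProj_single]
  rcases w with _ | ⟨b, w⟩ <;> simp

theorem cutSum_p_zero_right {M : Type*} [AddCommMonoid M] (w : List X)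
    (G : List X → Sh X → M) (hG : ∀ u, G u 0 = 0) :
    (cutSum w fun u v => G u (p wt 0 (Finsupp.single v 1))) = G w (Finsupp.single [] 1) := by
  induction w generalizing G with
  | nil => simp [p_zero_nil]
  | cons a w ih => rw [cutSum_cons, p_zero_cons, hG, zero_add, ih _ fun u => hG _]

theorem cutSum_p_zero_left {M : Type*} [AddCommMonoid M] (w : List X)
    (G : Sh X → List X → M) (hG : ∀ u, G 0 u = 0) :
    (cutSum w fun u v => G (p wt 0 (Finsupp.single u 1)) v) = G (Finsupp.single [] 1) w := by
  rcases w with _ | ⟨a, w⟩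
  · simp [p_zero_nil]
  · rw [cutSum_cons, p_zero_nil, cutSum_eq_zero, add_zero]
    intro u v _
    rw [p_zero_cons, hG]

theorem endPrec_p_zero_left (g : EndSh X) : endPrec X (p wt 0) g = 0 := by
  refine EndSh.ext_word fun w => ?_
  rw [endPrec_single, cutSum_p_zero_left wt w (fun x v => shPrec X x (g (Finsupp.single v 1)))]
  all_goals simp

theorem endSucc_p_zero_right (f : EndSh X) : endSucc X f (p wt 0) = 0 := by
  refine EndSh.ext_word fun w => ?_
  rw [endSucc_single, cutSum_p_zero_right wt w (fun u x => shPrec X x (f (Finsupp.single u 1)))]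
  all_goals simp

theorem endPrec_p_zero_right {f : EndSh X} (hf : ∀ x, f x [] = 0) :
    endPrec X f (p wt 0) = f := by
  refine EndSh.ext_word fun w => ?_
  rw [endPrec_single, cutSum_p_zero_right wt w (fun u x => shPrec X (f (Finsupp.single u 1)) x),
    shPrec_unit_right (hf _)]
  simp

theorem endSucc_p_zero_left {f : EndSh X} (hf : ∀ x, f x [] = 0) :
    endSucc X (p wt 0) f = f := by
  refine EndSh.ext_word fun w => ?_
  rw [endSucc_single, cutSum_p_zero_left wt w (fun x v => shPrec X (f (Finsupp.single v 1)) x),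
    shPrec_unit_right (hf _)]
  simp

/-- `π_n ≺ g` splits off a first letter of weight `n` and applies `g` to what follows. -/
theorem endPrec_letterProj_cons (n : ℕ+) (g : EndSh X) (a : X) (w : List X) :
    endPrec X (letterProj wt n) g (Finsupp.single (a :: w) 1) =
      if wt a = n then consMap a (g (Finsupp.single w 1)) else 0 := by
  have hcons : ∀ y : Sh X, shuffle X (Finsupp.single [] 1) y = y := by
    intro y
    induction y using Sh.induction <;> simp_all
  rw [endPrec_single, cutSum_cons, letterProj_nil, map_zero, LinearMap.zero_apply, zero_add]
  rcases w with _ | ⟨b, w⟩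
  · rw [cutSum_nil, letterProj_cons]
    split_ifs with h1 h2 h2
    · rw [← consMap_single, shPrec_consMap, hcons]
    all_goals simp_all
  · rw [cutSum_cons, cutSum_eq_zero, add_zero, letterProj_cons]
    · split_ifs with h1 h2 h2
      · rw [← consMap_single, shPrec_consMap, hcons]
      all_goals simp_all
    · intro u v _
      rw [letterProj_cons]
      simp

theorem endPrec_letterProj_nil (n : ℕ+) (g : EndSh X) :
    endPrec X (letterProj wt n) g (Finsupp.single [] 1) = 0 :=
  conv_apply_nil _ _ _ (letterProj_nil wt n)

theorem anagramEnd_conv {f g : EndSh X} (hf : f ∈ anagramEnd X) (hg : g ∈ anagramEnd X) :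
    endPrec X f g ∈ anagramEnd X ∧ endSucc X f g ∈ anagramEnd X := by
  constructor
  · intro w z h
    rw [endPrec_single] at h
    obtain ⟨u, v, rfl, h'⟩ := exists_of_cutSum_apply_ne_zero h
    obtain ⟨u', v', hu, hv, h'⟩ := exists_of_shPrec_apply_ne_zero h'
    exact (perm_of_precWord_apply_ne_zero h').trans ((hf _ _ hu).append (hg _ _ hv))
  · intro w z h
    rw [endSucc_single] at h
    obtain ⟨u, v, rfl, h'⟩ := exists_of_cutSum_apply_ne_zero h
    obtain ⟨v', u', hv, hu, h'⟩ := exists_of_shPrec_apply_ne_zero h'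
    exact (perm_of_precWord_apply_ne_zero h').trans
      (List.perm_append_comm.trans ((hf _ _ hu).append (hg _ _ hv)))

theorem p_mem_anagramEnd (n : ℕ) : p wt n ∈ anagramEnd X := by
  intro w z h
  rw [p_single] at h
  split_ifs at h
  · rw [(Finsupp.single_apply_ne_zero.1 h).1]
  · simp at h

theorem descd_le {A : Submodule ℚ (EndSh X)} (hp : ∀ n, p wt n ∈ A)
    (hA : ∀ f ∈ A, ∀ g ∈ A, endPrec X f g ∈ A ∧ endSucc X f g ∈ A) : descd wt ≤ A :=
  sInf_le ⟨hp, hA⟩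

theorem descd_le_anagramEnd : descd wt ≤ anagramEnd X :=
  descd_le wt (p_mem_anagramEnd wt) fun _ hf _ hg => anagramEnd_conv hf hg

theorem p_mem_descd (n : ℕ) : p wt n ∈ descd wt := by
  simp only [descd, Submodule.mem_sInf]
  exact fun A hA => hA.1 n

theorem mem_descdPlus {f : EndSh X} :
    f ∈ descdPlus wt ↔ f ∈ descd wt ∧ f (Finsupp.single [] 1) = 0 := Iff.rfl

theorem apply_nil_of_mem_descdPlus {f : EndSh X} (hf : f ∈ descdPlus wt) (x : Sh X) :
    f x [] = 0 := by
  induction x using Sh.induction with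
  | zero => simp
  | add x y hx hy => simp [hx, hy]
  | smul c x hx => simp [hx]
  | word w =>
    by_contra h
    obtain rfl := List.nil_perm.1 (descd_le_anagramEnd wt hf.1 _ _ h)
    exact h (by rw [((mem_descdPlus wt).1 hf).2]; rfl)

theorem isDendriform_descd : IsDendriform (V := descdPlus wt) (descdPrec wt) (descdSucc wt) where
  prec_star _ y _ := Subtype.ext <| endPrec_endPrec (apply_nil_of_mem_descdPlus wt y.2)
  star_succ _ y _ := Subtype.ext <| endSucc_endSucc (apply_nil_of_mem_descdPlus wt y.2)
  succ_prec _ _ _ := Subtype.ext <| endPrec_endSucc _ _ _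

/-- A word of positive weight is its first letter followed by a possibly empty word:
`p_{n+1} = ∑ π_{i+1} ≺ p_{n-i}`. -/
theorem p_succ (n : ℕ) : p wt (n + 1) =
    ∑ i ∈ Finset.range (n + 1), endPrec X (letterProj wt i.succPNat) (p wt (n - i)) := by
  refine EndSh.ext_word fun w => ?_
  rw [LinearMap.sum_apply]
  rcases w with _ | ⟨a, w⟩
  · simp [endPrec_letterProj_nil, p_single]
  · simp only [endPrec_letterProj_cons, p_single]
    have e : ∀ i, i.succPNat = wt a ↔ i = (wt a : ℕ) - 1 := by
      intro i
      rw [← PNat.coe_inj, Nat.succPNat_coe]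
      have := (wt a).pos
      omega
    simp only [eq_comm (a := wt a), e, Finset.sum_ite_eq', Finset.mem_range]
    have := (wt a).pos
    rw [weight_cons]
    split_ifs <;> first | omega | simp

theorem letterProj_apply_nil (n : ℕ+) (x : Sh X) : letterProj wt n x [] = 0 := by
  induction x using Sh.induction with
  | zero => simp
  | add x y hx hy => simp [hx, hy]
  | smul c x hx => simp [hx]
  | word w =>
    rw [letterProj_single]
    split_ifs with h
    · rw [Finsupp.single_eq_of_ne]
      rintro rfl
      simp at h
    · rfl

theorem p_succ_eq_letterProj_add (n : ℕ) : p wt (n + 1) = letterProj wt n.succPNat +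
    ∑ i ∈ Finset.range n, endPrec X (letterProj wt i.succPNat) (p wt (n - i)) := by
  rw [p_succ, Finset.sum_range_succ, Nat.sub_self,
    endPrec_p_zero_right wt (letterProj_apply_nil wt _), add_comm]

theorem letterProj_succPNat_mem_descd (n : ℕ) : letterProj wt n.succPNat ∈ descd wt := by
  induction n using Nat.strong_induction_on with
  | _ n ih =>
    rw [← add_sub_cancel_right (letterProj wt n.succPNat) (∑ i ∈ Finset.range n,
      endPrec X (letterProj wt i.succPNat) (p wt (n - i))), ← p_succ_eq_letterProj_add]
    exact sub_mem (p_mem_descd wt _) (sum_mem fun i hi =>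
      (descd_closed wt (ih i (Finset.mem_range.1 hi)) (p_mem_descd wt _)).1)

theorem letterProj_mem_descdPlus (n : ℕ+) : letterProj wt n ∈ descdPlus wt := by
  refine ⟨?_, letterProj_nil wt n⟩
  have := letterProj_succPNat_mem_descd wt n.natPred
  rwa [PNat.succPNat_natPred] at this

/-- A subspace of `End (Sh X)` that contains the letter projections and is stable under both
half-products contains the augmentation ideal of `Descd`: the projections `p n`, `n ≥ 1`, are
obtained from the letter projections, and `p 0` is a unit. -/
theorem descdPlus_le {W : Submodule ℚ (EndSh X)} (hW : W ≤ descdPlus wt)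
    (hπ : ∀ n, letterProj wt n ∈ W)
    (hmul : ∀ f ∈ W, ∀ g ∈ W, endPrec X f g ∈ W ∧ endSucc X f g ∈ W) : descdPlus wt ≤ W := by
  have hp : ∀ n, p wt (n + 1) ∈ W := by
    intro n
    induction n using Nat.strong_induction_on with
    | _ n ih =>
      rw [p_succ_eq_letterProj_add]
      refine add_mem (hπ _) (sum_mem fun i hi => (hmul _ (hπ _) _ ?_).1)
      have hi := Finset.mem_range.1 hi
      have := ih (n - i - 1) (by omega)
      rwa [show n - i - 1 + 1 = n - i by omega] at this
  have nil : ∀ {f}, f ∈ W → ∀ x, f x [] = 0 := fun hf => apply_nil_of_mem_descdPlus wt (hW hf)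
  have hle : descd wt ≤ Submodule.span ℚ {p wt 0} ⊔ W := by
    refine descd_le wt ?_ ?_
    · rintro (_ | n)
      · exact Submodule.mem_sup_left (Submodule.mem_span_singleton_self _)
      · exact Submodule.mem_sup_right (hp n)
    · intro f hf g hg
      obtain ⟨_, hc, f, hf', rfl⟩ := Submodule.mem_sup.1 hf
      obtain ⟨_, hd, g, hg', rfl⟩ := Submodule.mem_sup.1 hg
      obtain ⟨c, rfl⟩ := Submodule.mem_span_singleton.1 hc
      obtain ⟨d, rfl⟩ := Submodule.mem_span_singleton.1 hd
      simp only [map_add, LinearMap.add_apply, map_smul, LinearMap.smul_apply,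
        endPrec_p_zero_left, endSucc_p_zero_right, smul_zero, zero_add, add_zero,
        endPrec_p_zero_right wt (nil hf'), endSucc_p_zero_left wt (nil hg')]
      exact ⟨Submodule.mem_sup_right (add_mem (W.smul_mem _ hf') (hmul _ hf' _ hg').1),
        Submodule.mem_sup_right (add_mem (W.smul_mem _ hg') (hmul _ hf' _ hg').2)⟩
  intro f hf
  obtain ⟨_, hc, g, hg, rfl⟩ := Submodule.mem_sup.1 (hle hf.1)
  obtain ⟨c, rfl⟩ := Submodule.mem_span_singleton.1 hc
  have h := ((mem_descdPlus wt).1 hf).2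
  rw [LinearMap.add_apply, LinearMap.smul_apply, p_zero_nil,
    ((mem_descdPlus wt).1 (hW hg)).2, add_zero, smul_eq_zero] at h
  rcases h with rfl | h
  · simpa using hg
  · simp at h

theorem descd_eq_span_sup_descdPlus :
    Disjoint (Submodule.span ℚ {p wt 0}) (descdPlus wt) ∧
      Submodule.span ℚ {p wt 0} ⊔ descdPlus wt = descd wt := by
  constructor
  · rw [Submodule.disjoint_def]
    intro f hf hf'
    obtain ⟨c, rfl⟩ := Submodule.mem_span_singleton.1 hf
    have h := ((mem_descdPlus wt).1 hf').2
    rw [LinearMap.smul_apply, p_zero_nil, smul_eq_zero] at h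
    rcases h with rfl | h
    · simp
    · simp at h
  · refine le_antisymm (sup_le ?_ inf_le_left) fun f hf => ?_
    · rw [Submodule.span_singleton_le_iff_mem]
      exact p_mem_descd wt 0
    · -- An anagram of the empty word is empty, so `f` sends the unit to a multiple of it.
      set c := f (Finsupp.single [] 1) [] with hc
      refine Submodule.mem_sup.2 ⟨c • p wt 0, Submodule.smul_mem _ _
        (Submodule.mem_span_singleton_self _), f - c • p wt 0, ?_, by abel⟩
      refine (mem_descdPlus wt).2
        ⟨sub_mem hf (Submodule.smul_mem _ _ (p_mem_descd wt 0)), ?_⟩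
      rw [LinearMap.sub_apply, LinearMap.smul_apply, p_zero_nil, sub_eq_zero]
      ext z
      by_cases hz : z = []
      · simp [hz, hc]
      · rw [Finsupp.smul_apply, Finsupp.single_eq_of_ne hz, smul_zero]
        by_contra h
        exact hz (List.perm_nil.1 (descd_le_anagramEnd wt hf _ _ h))

end Descd

/-! ### Evaluation of decorated binary trees in a dendriform algebra -/

section TreeEval

variable {ι : Type*}

/-- The product of two decorated binary trees in the free dendriform algebra, with the empty tree
as unit: the root of a term of `s * t` is the root of `s` or the root of `t`. -/
noncomputable def treeStar : BinaryTree ι → BinaryTree ι → (BinaryTree ι →₀ ℚ)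
  | nil, t => Finsupp.single t 1
  | node a l r, nil => Finsupp.single (node a l r) 1
  | node a l r, node b l' r' =>
      Finsupp.mapDomain (node a l) (treeStar r (node b l' r')) +
        Finsupp.mapDomain (fun t => node b t r') (treeStar (node a l r) l')
  termination_by s t => s.numNodes + t.numNodes

/-- The half-product `s ≺ t` of decorated binary trees, which keeps the root of `s`. -/
noncomputable def treePrec : BinaryTree ι → BinaryTree ι → (BinaryTree ι →₀ ℚ)
  | nil, _ => 0
  | node a l r, t => Finsupp.mapDomain (node a l) (treeStar r t)

/-- The half-product `s ≻ t` of decorated binary trees, which keeps the root of `t`. -/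
noncomputable def treeSucc : BinaryTree ι → BinaryTree ι → (BinaryTree ι →₀ ℚ)
  | _, nil => 0
  | s, node b l' r' => Finsupp.mapDomain (fun t => node b t r') (treeStar s l')

variable {V : Type*} [AddCommGroup V] [Module ℚ V] (l r : V →ₗ[ℚ] V →ₗ[ℚ] V) (g : ι → V)

/-- The evaluation of a decorated tree with root `n` and subtrees `s` and `t` is
`s ≻ (g n ≺ t)`, where empty subtrees act as a unit.  The empty tree, whose value would be the
unit that `V` lacks, gets the value `0`; its scalar part is kept track of by the coefficient of
`nil`. -/
noncomputable def treeEval : BinaryTree ι → V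
  | nil => 0
  | node n s t =>
      (Finsupp.single s 1 : BinaryTree ι →₀ ℚ) nil •
          ((Finsupp.single t 1 : BinaryTree ι →₀ ℚ) nil • g n + l (g n) (treeEval t)) +
        r (treeEval s) ((Finsupp.single t 1 : BinaryTree ι →₀ ℚ) nil • g n +
          l (g n) (treeEval t))

/-- The linear extension of `treeEval`. -/
noncomputable def treeEvalLin : (BinaryTree ι →₀ ℚ) →ₗ[ℚ] V :=
  Finsupp.linearCombination ℚ (treeEval l r g)

/-- The map `x ↦ x ≺ c` for a combination `c` of trees, the empty tree acting as a unit. -/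
noncomputable def precAct (c : BinaryTree ι →₀ ℚ) (x : V) : V :=
  c nil • x + l x (treeEvalLin l r g c)

/-- The map `x ↦ c ≻ x` for a combination `c` of trees, the empty tree acting as a unit. -/
noncomputable def succAct (c : BinaryTree ι →₀ ℚ) (x : V) : V :=
  c nil • x + r (treeEvalLin l r g c) x

@[simp] theorem treeEvalLin_single (t : BinaryTree ι) (c : ℚ) :
    treeEvalLin l r g (Finsupp.single t c) = c • treeEval l r g t := by
  simp [treeEvalLin]

@[simp] theorem treeEval_nil : treeEval l r g nil = 0 := rfl

theorem treeEval_node (n : ι) (s t : BinaryTree ι) : treeEval l r g (node n s t) =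
    succAct l r g (Finsupp.single s 1) (precAct l r g (Finsupp.single t 1) (g n)) := by
  simp [treeEval, succAct, precAct]

theorem single_node_nil (n : ι) (s t : BinaryTree ι) (c : ℚ) :
    (Finsupp.single (node n s t) c : BinaryTree ι →₀ ℚ) nil = 0 := by
  simp

theorem precAct_single_of_ne_nil {t : BinaryTree ι} (ht : t ≠ nil) (x : V) :
    precAct l r g (Finsupp.single t 1) x = l x (treeEval l r g t) := by
  simp [precAct, Finsupp.single_eq_of_ne ht.symm]

theorem succAct_single_of_ne_nil {t : BinaryTree ι} (ht : t ≠ nil) (x : V) :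
    succAct l r g (Finsupp.single t 1) x = r (treeEval l r g t) x := by
  simp [succAct, Finsupp.single_eq_of_ne ht.symm]

theorem precAct_single_nil (x : V) : precAct l r g (Finsupp.single nil 1) x = x := by
  simp [precAct]

theorem succAct_single_nil (x : V) : succAct l r g (Finsupp.single nil 1) x = x := by
  simp [succAct]

theorem treeEvalLin_mapDomain_right (n : ι) (s : BinaryTree ι) (c : BinaryTree ι →₀ ℚ) :
    treeEvalLin l r g (Finsupp.mapDomain (node n s) c) =
      succAct l r g (Finsupp.single s 1) (precAct l r g c (g n)) := by
  induction c using Finsupp.induction_linear with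
  | zero => simp [precAct, succAct]
  | add c d hc hd =>
    rw [Finsupp.mapDomain_add, map_add, hc, hd]
    simp only [precAct, succAct, Finsupp.add_apply, map_add, add_smul, smul_add]
    abel
  | single t q =>
    rw [Finsupp.mapDomain_single, treeEvalLin_single, treeEval_node,
      ← mul_one q, ← smul_eq_mul, ← Finsupp.smul_single]
    simp only [precAct, succAct, Finsupp.smul_apply, map_add, map_smul, smul_add, mul_smul q,
      smul_eq_mul, mul_one]
    simp only [smul_comm q]

theorem treeEvalLin_mapDomain_left (n : ι) (t : BinaryTree ι) (c : BinaryTree ι →₀ ℚ) :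
    treeEvalLin l r g (Finsupp.mapDomain (fun s => node n s t) c) =
      succAct l r g c (precAct l r g (Finsupp.single t 1) (g n)) := by
  induction c using Finsupp.induction_linear with
  | zero => simp [succAct]
  | add c d hc hd =>
    rw [Finsupp.mapDomain_add, map_add, hc, hd]
    simp only [succAct, Finsupp.add_apply, map_add, add_smul, LinearMap.add_apply]
    abel
  | single s q =>
    rw [Finsupp.mapDomain_single, treeEvalLin_single, treeEval_node,
      ← mul_one q, ← smul_eq_mul, ← Finsupp.smul_single]
    simp only [succAct, Finsupp.smul_apply, map_smul, smul_add, mul_smul q, LinearMap.smul_apply,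
      smul_eq_mul, mul_one]

variable {l r}

theorem precAct_succAct (h : IsDendriform l r) (c d : BinaryTree ι →₀ ℚ) (x : V) :
    precAct l r g c (succAct l r g d x) = succAct l r g d (precAct l r g c x) := by
  simp only [precAct, succAct, map_add, map_smul, LinearMap.add_apply, LinearMap.smul_apply,
    h.succ_prec, smul_add, smul_comm (d nil)]
  abel

theorem treeStar_nil_left (t : BinaryTree ι) : treeStar nil t = Finsupp.single t 1 := by
  rw [treeStar]

theorem treeStar_nil_right (t : BinaryTree ι) : treeStar t nil = Finsupp.single t 1 := by
  cases t <;> rw [treeStar]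

theorem treeStar_apply_nil (s t : BinaryTree ι) : treeStar s t nil =
    (Finsupp.single s 1 : BinaryTree ι →₀ ℚ) nil *
      (Finsupp.single t 1 : BinaryTree ι →₀ ℚ) nil := by
  rcases s with _ | ⟨a, s, s'⟩
  · simp [treeStar_nil_left]
  rcases t with _ | ⟨b, t, t'⟩
  · simp [treeStar_nil_right]
  rw [treeStar, Finsupp.add_apply, Finsupp.mapDomain_of_notMem_range _ _ (by simp),
    Finsupp.mapDomain_of_notMem_range _ _ (by simp)]
  simp

/-- The evaluation is multiplicative in the algebra `V` with a unit adjoined. -/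
theorem treeEvalLin_treeStar (h : IsDendriform l r) (s t : BinaryTree ι) :
    treeEvalLin l r g (treeStar s t) =
      (Finsupp.single t 1 : BinaryTree ι →₀ ℚ) nil • treeEval l r g s +
      (Finsupp.single s 1 : BinaryTree ι →₀ ℚ) nil • treeEval l r g t +
      (l (treeEval l r g s) (treeEval l r g t) + r (treeEval l r g s) (treeEval l r g t)) ∧
    (∀ x, precAct l r g (treeStar s t) x =
      precAct l r g (Finsupp.single t 1) (precAct l r g (Finsupp.single s 1) x)) ∧
    ∀ x, succAct l r g (treeStar s t) x =
      succAct l r g (Finsupp.single s 1) (succAct l r g (Finsupp.single t 1) x) := by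
  induction s, t using treeStar.induct with
  | case1 t => simp [treeStar_nil_left, precAct_single_nil, succAct_single_nil]
  | case2 a s s' =>
    rw [treeStar_nil_right]
    simp [precAct_single_nil, succAct_single_nil]
  | case3 a s s' b t t' ih ih' =>
    have key : treeEvalLin l r g (treeStar (node a s s') (node b t t')) =
        l (treeEval l r g (node a s s')) (treeEval l r g (node b t t')) +
          r (treeEval l r g (node a s s')) (treeEval l r g (node b t t')) := by
      rw [treeStar, map_add, treeEvalLin_mapDomain_right, treeEvalLin_mapDomain_left, ih.2.1,
        ih'.2.2, ← precAct_succAct g h, ← treeEval_node, ← treeEval_node,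
        precAct_single_of_ne_nil _ _ _ (by simp), succAct_single_of_ne_nil _ _ _ (by simp)]
    refine ⟨by rw [key, single_node_nil, single_node_nil, zero_smul, zero_smul, zero_add,
      zero_add], fun x => ?_, fun x => ?_⟩
    · rw [precAct, treeStar_apply_nil, key, h.prec_star,
        precAct_single_of_ne_nil _ _ _ (by simp), precAct_single_of_ne_nil _ _ _ (by simp),
        single_node_nil, zero_mul, zero_smul, zero_add]
    · rw [succAct, treeStar_apply_nil, key, h.star_succ,
        succAct_single_of_ne_nil _ _ _ (by simp), succAct_single_of_ne_nil _ _ _ (by simp),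
        single_node_nil, zero_mul, zero_smul, zero_add]

theorem treeEvalLin_treePrec (h : IsDendriform l r) (s : BinaryTree ι) {t : BinaryTree ι}
    (ht : t ≠ nil) : treeEvalLin l r g (treePrec s t) =
      l (treeEval l r g s) (treeEval l r g t) := by
  rcases s with _ | ⟨a, s, s'⟩
  · simp [treePrec]
  rw [treePrec, treeEvalLin_mapDomain_right, (treeEvalLin_treeStar g h s' t).2.1,
    ← precAct_succAct g h, ← treeEval_node, precAct_single_of_ne_nil _ _ _ ht]

theorem treeEvalLin_treeSucc (h : IsDendriform l r) {s : BinaryTree ι} (t : BinaryTree ι)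
    (hs : s ≠ nil) : treeEvalLin l r g (treeSucc s t) =
      r (treeEval l r g s) (treeEval l r g t) := by
  rcases t with _ | ⟨b, t, t'⟩
  · simp [treeSucc]
  rw [treeSucc, treeEvalLin_mapDomain_left, (treeEvalLin_treeStar g h s t).2.2,
    ← treeEval_node, succAct_single_of_ne_nil _ _ _ hs]

/-- The evaluations of trees span a dendriform subalgebra. -/
theorem mul_mem_range_treeEvalLin (h : IsDendriform l r) {x y : V}
    (hx : x ∈ LinearMap.range (treeEvalLin l r g)) (hy : y ∈ LinearMap.range (treeEvalLin l r g)) :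
    l x y ∈ LinearMap.range (treeEvalLin l r g) ∧
      r x y ∈ LinearMap.range (treeEvalLin l r g) := by
  set R := LinearMap.range (treeEvalLin l r g) with hR
  obtain ⟨c, rfl⟩ := hx
  obtain ⟨d, rfl⟩ := hy
  induction c using Finsupp.induction_linear with
  | zero => simp
  | add c c' hc hc' =>
    simp only [map_add, LinearMap.add_apply]
    exact ⟨add_mem hc.1 hc'.1, add_mem hc.2 hc'.2⟩
  | single s q =>
  induction d using Finsupp.induction_linear with
  | zero => simp
  | add c c' hc hc' =>
    simp only [map_add]
    exact ⟨add_mem hc.1 hc'.1, add_mem hc.2 hc'.2⟩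
  | single t q' =>
  simp only [treeEvalLin_single, map_smul, LinearMap.smul_apply]
  by_cases hs : s = nil
  · simp [hs]
  by_cases ht : t = nil
  · simp [ht]
  rw [← treeEvalLin_treePrec g h _ ht, ← treeEvalLin_treeSucc g h _ hs]
  exact ⟨R.smul_mem _ (R.smul_mem _ ⟨_, rfl⟩), R.smul_mem _ (R.smul_mem _ ⟨_, rfl⟩)⟩

theorem map_treeEval {D : Type*} [AddCommGroup D] [Module ℚ D] {l' r' : D →ₗ[ℚ] D →ₗ[ℚ] D}
    (φ : V →ₗ[ℚ] D) (hl : ∀ x y, φ (l x y) = l' (φ x) (φ y))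
    (hr : ∀ x y, φ (r x y) = r' (φ x) (φ y)) (t : BinaryTree ι) :
    φ (treeEval l r g t) = treeEval l' r' (fun n => φ (g n)) t := by
  induction t with
  | nil => simp
  | node n s t hs ht => simp [treeEval, hl, hr, hs, ht]

theorem treeEval_leaf (n : ι) : treeEval l r g (node n nil nil) = g n := by
  simp [treeEval]

/-- A dendriform algebra is free as soon as the evaluations of the nonempty trees form a basis:
the half-products of two such evaluations are expanded by the rules for trees, which do not depend
on the algebra. -/
theorem isFreeDendriform_of_basis.{v, i, w0} {ι : Type i} {V : Type v} [AddCommGroup V]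
    [Module ℚ V] {l r : V →ₗ[ℚ] V →ₗ[ℚ] V} {g : ι → V} (h : IsDendriform l r)
    (b : Module.Basis {t : BinaryTree ι // t ≠ nil} ℚ V)
    (hb : ∀ t, b t = treeEval l r g t) : IsFreeDendriform.{v, i, w0} l r g := by
  refine ⟨h, fun D _ _ l' r' h' a => ?_⟩
  set φ : V →ₗ[ℚ] D := b.constr ℚ fun t => treeEval l' r' a t with hφ
  have eval : ∀ t, φ (treeEval l r g t) = treeEval l' r' a t := by
    intro t
    by_cases ht : t = nil
    · subst ht; simp
    · rw [← hb ⟨t, ht⟩, hφ, Module.Basis.constr_basis]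
  have evalLin : ∀ c, φ (treeEvalLin l r g c) = treeEvalLin l' r' a c := by
    intro c
    induction c using Finsupp.induction_linear with
    | zero => simp
    | add c d hc hd => simp [hc, hd]
    | single t q => simp [eval]
  have prec : l.compr₂ φ = l'.compl₁₂ φ φ := by
    refine b.ext fun s => b.ext fun t => ?_
    simp only [LinearMap.compr₂_apply, LinearMap.compl₁₂_apply, hb, eval]
    rw [← treeEvalLin_treePrec g h _ t.2, evalLin, treeEvalLin_treePrec a h' _ t.2]
  have succ : r.compr₂ φ = r'.compl₁₂ φ φ := by
    refine b.ext fun s => b.ext fun t => ?_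
    simp only [LinearMap.compr₂_apply, LinearMap.compl₁₂_apply, hb, eval]
    rw [← treeEvalLin_treeSucc g h _ s.2, evalLin, treeEvalLin_treeSucc a h' _ s.2]
  refine ⟨φ, ⟨fun x y => LinearMap.congr_fun₂ prec x y, fun x y => LinearMap.congr_fun₂ succ x y,
    fun n => ?_⟩, ?_⟩
  · have := eval (node n nil nil)
    rwa [treeEval_leaf, treeEval_leaf] at this
  · rintro ψ ⟨hl, hr, hg⟩
    refine b.ext fun t => ?_
    rw [hb, eval, map_treeEval g ψ hl hr]
    simp only [hg]

end TreeEval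

/-! ### The endomorphism attached to a decorated tree -/

section TreeEnd

variable {X : Type*} (wt : X → ℕ+)

/-- The endomorphism of `Sh X` attached to a tree with nodes decorated by weights.  It sends a word
to the sum of the words obtained by listing its letters in the order of a linear extension of the
tree, the letters being the nodes in infix order; the empty tree gives the unit `p 0`. -/
noncomputable def treeEnd : BinaryTree ℕ+ → EndSh X
  | nil => p wt 0
  | node n s t => endSucc X (treeEnd s) (endPrec X (letterProj wt n) (treeEnd t))

theorem treeEnd_node_single (n : ℕ+) (s t : BinaryTree ℕ+) (w : List X) :
    treeEnd wt (node n s t) (Finsupp.single w 1) = cutSum w fun u q =>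
      shPrec X (endPrec X (letterProj wt n) (treeEnd wt t) (Finsupp.single q 1))
        (treeEnd wt s (Finsupp.single u 1)) := by
  rw [treeEnd, endSucc_single]

theorem shPrec_endPrec_letterProj_cons (n : ℕ+) (g : EndSh X) (a : X) (w : List X) (y : Sh X) :
    shPrec X (endPrec X (letterProj wt n) g (Finsupp.single (a :: w) 1)) y =
      if wt a = n then consMap a (shuffle X (g (Finsupp.single w 1)) y) else 0 := by
  rw [endPrec_letterProj_cons]
  split_ifs
  · rw [shPrec_consMap]
  · simp

/-- A term of the value of a tree at a word comes from a factorization `u y v`, where the letter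
`y` corresponds to the root and is put in front. -/
theorem exists_of_treeEnd_node_apply_ne_zero {n : ℕ+} {s t : BinaryTree ℕ+} {w z : List X}
    (h : treeEnd wt (node n s t) (Finsupp.single w 1) z ≠ 0) :
    ∃ u y v z', w = u ++ y :: v ∧ z = y :: z' ∧ wt y = n ∧
      shuffle X (treeEnd wt t (Finsupp.single v 1)) (treeEnd wt s (Finsupp.single u 1)) z' ≠ 0 := by
  rw [treeEnd_node_single] at h
  obtain ⟨u, q, rfl, h'⟩ := exists_of_cutSum_apply_ne_zero h
  rcases q with _ | ⟨y, v⟩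
  · simp [endPrec_letterProj_nil] at h'
  rw [shPrec_endPrec_letterProj_cons] at h'
  split_ifs at h' with hy
  · obtain ⟨z', rfl, h''⟩ := exists_of_consMap_apply_ne_zero h'
    exact ⟨u, y, v, z', rfl, rfl, hy, h''⟩
  · simp at h'

theorem treeEnd_node_apply_cons (n : ℕ+) (s t : BinaryTree ℕ+) {u v : List X} {y : X}
    (hn : (u ++ y :: v).Nodup) (z : List X) :
    treeEnd wt (node n s t) (Finsupp.single (u ++ y :: v) 1) (y :: z) =
      if wt y = n then shuffle X (treeEnd wt t (Finsupp.single v 1))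
        (treeEnd wt s (Finsupp.single u 1)) z else 0 := by
  rw [treeEnd_node_single, ← Finsupp.applyAddHom_apply, map_cutSum, cutSum_eq_single hn]
  · rw [shPrec_endPrec_letterProj_cons]
    split_ifs <;> simp
  · simp [endPrec_letterProj_nil]
  · intro p x q hx
    rw [shPrec_endPrec_letterProj_cons]
    split_ifs
    · exact consMap_apply_cons_of_ne hx.symm _ _
    · simp

theorem treeEnd_mem_descd (t : BinaryTree ℕ+) : treeEnd wt t ∈ descd wt := by
  induction t with
  | nil => exact p_mem_descd wt 0
  | node n s t hs ht =>
    exact (descd_closed wt hs (descd_closed wt (letterProj_mem_descdPlus wt n).1 ht).1).2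

theorem perm_of_treeEnd_apply_ne_zero {t : BinaryTree ℕ+} {w z : List X}
    (h : treeEnd wt t (Finsupp.single w 1) z ≠ 0) : z.Perm w :=
  descd_le_anagramEnd wt (treeEnd_mem_descd wt t) w z h

/-- The letter projections, as elements of the augmentation ideal. -/
noncomputable def letterGen (n : ℕ+) : descdPlus wt :=
  ⟨letterProj wt n, letterProj_mem_descdPlus wt n⟩

theorem treeEnd_eq_add_treeEval (t : BinaryTree ℕ+) : treeEnd wt t =
    (Finsupp.single t 1 : BinaryTree ℕ+ →₀ ℚ) nil • p wt 0 +
      (treeEval (V := descdPlus wt) (descdPrec wt) (descdSucc wt) (letterGen wt) t : EndSh X) := by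
  induction t with
  | nil => simp [treeEnd]
  | node n s t hs ht =>
    have coe_prec : ∀ x y : descdPlus wt, ((descdPrec wt x y : descdPlus wt) : EndSh X) =
      endPrec X x y := fun _ _ => rfl
    have coe_succ : ∀ x y : descdPlus wt, ((descdSucc wt x y : descdPlus wt) : EndSh X) =
      endSucc X x y := fun _ _ => rfl
    have h1 : ∀ f : descdPlus wt, endPrec X f (treeEnd wt t) =
        precAct (V := descdPlus wt) (descdPrec wt) (descdSucc wt) (letterGen wt)
          (Finsupp.single t 1) f := by
      intro f
      rw [ht, map_add, map_smul, endPrec_p_zero_right wt (apply_nil_of_mem_descdPlus wt f.2)]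
      simp [precAct, coe_prec]
    have h2 : ∀ f : descdPlus wt, endSucc X (treeEnd wt s) f =
        succAct (V := descdPlus wt) (descdPrec wt) (descdSucc wt) (letterGen wt)
          (Finsupp.single s 1) f := by
      intro f
      rw [hs, map_add, map_smul, LinearMap.add_apply, LinearMap.smul_apply,
        endSucc_p_zero_left wt (apply_nil_of_mem_descdPlus wt f.2)]
      simp [succAct, coe_succ]
    rw [single_node_nil, zero_smul, zero_add, treeEval_node, treeEnd, ← h2, ← h1]
    rfl

theorem coe_treeEval_of_ne_nil {t : BinaryTree ℕ+} (ht : t ≠ nil) :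
    (treeEval (V := descdPlus wt) (descdPrec wt) (descdSucc wt) (letterGen wt) t : EndSh X) =
      treeEnd wt t := by
  rw [treeEnd_eq_add_treeEval, Finsupp.single_eq_of_ne ht.symm, zero_smul, zero_add]

end TreeEnd

/-! ### Words attached to a tree with distinct labels -/

section Labelled

variable {X : Type*}

/-- The labels of a tree in infix order. -/
def inorder : BinaryTree X → List X
  | nil => []
  | node y s t => inorder s ++ y :: inorder t

/-- The labels of a tree in the prefix order that visits right subtrees before left ones; thus
the leftmost node and its right subtree come last. -/
def preorderRight : BinaryTree X → List X
  | nil => []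
  | node y s t => y :: (preorderRight t ++ preorderRight s)

theorem preorderRight_perm (t : BinaryTree X) : (preorderRight t).Perm (inorder t) := by
  induction t with
  | nil => simp [preorderRight, inorder]
  | node y s t hs ht =>
    rw [preorderRight, inorder]
    exact ((List.perm_append_comm.trans (hs.append ht)).cons y).trans List.perm_middle.symm

open Classical in
/-- The shuffle of combinations of words over disjoint alphabets. -/
theorem shuffle_apply_of_separated (P : X → Prop) {x y : Sh X}
    (hx : ∀ u, x u ≠ 0 → ∀ a ∈ u, P a) (hy : ∀ v, y v ≠ 0 → ∀ b ∈ v, ¬ P b) (z : List X) :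
    shuffle X x y z = x (z.filter fun a => P a) * y (z.filter fun a => ¬ P a) := by
  rw [shuffle, Finsupp.linearCombination_apply, Finsupp.sum, LinearMap.sum_apply,
    Finsupp.finsetSum_apply, Finset.sum_eq_single (z.filter fun a => P a)]
  · rw [LinearMap.smul_apply, Finsupp.smul_apply, smul_eq_mul]
    by_cases h0 : x (z.filter fun a => P a) = 0
    · simp [h0]
    congr 1
    rw [Finsupp.linearCombination_apply, Finsupp.sum, Finsupp.finsetSum_apply,
      Finset.sum_eq_single (z.filter fun a => ¬ P a)]
    · by_cases h1 : y (z.filter fun a => ¬ P a) = 0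
      · rw [h1, zero_smul, Finsupp.zero_apply]
      · rw [Finsupp.smul_apply, shuffleWord_apply P (hx _ h0) (hy _ h1), if_pos ⟨rfl, rfl⟩,
          smul_eq_mul, mul_one]
    · intro v hv hne
      rw [Finsupp.smul_apply, shuffleWord_apply P (hx _ h0) (hy _ (Finsupp.mem_support_iff.1 hv)),
        if_neg, smul_zero]
      rintro ⟨-, h⟩
      exact hne h.symm
    · intro h
      rw [Finsupp.notMem_support_iff.1 h, zero_smul, Finsupp.zero_apply]
  · intro u hu hne
    rw [LinearMap.smul_apply, Finsupp.smul_apply]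
    by_contra h
    have h := right_ne_zero_of_mul h
    rw [Finsupp.linearCombination_apply, Finsupp.sum, Finsupp.finsetSum_apply] at h
    obtain ⟨v, hv, h⟩ := Finset.exists_ne_zero_of_sum_ne_zero h
    rw [Finsupp.smul_apply, shuffleWord_apply P (hx _ (Finsupp.mem_support_iff.1 hu))
      (hy _ (Finsupp.mem_support_iff.1 hv)), if_neg, smul_zero] at h
    · exact h rfl
    · rintro ⟨h, -⟩
      exact hne h.symm
  · intro h
    rw [Finsupp.notMem_support_iff.1 h, zero_smul]
    rfl

open Classical in
theorem filter_append_of_separated (P : X → Prop) {u v : List X}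
    (hu : ∀ a ∈ u, P a) (hv : ∀ b ∈ v, ¬ P b) :
    (u ++ v).filter (fun a => P a) = u ∧ (u ++ v).filter (fun a => ¬ P a) = v := by
  simp only [List.filter_append]
  rw [List.filter_eq_self.2 (by simpa using hu), List.filter_eq_nil_iff.2 (by simpa using hv),
    List.filter_eq_nil_iff.2 (by simpa using hu), List.filter_eq_self.2 (by simpa using hv)]
  simp

variable (wt : X → ℕ+)

open Classical in
/-- On the infix word of a tree `τ` with distinct labels, the word `preorderRight τ` occurs in the
value of exactly one decorated tree, the one that underlies `τ`. -/
theorem treeEnd_inorder_preorderRight (τ : BinaryTree X) (hτ : (inorder τ).Nodup)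
    (t : BinaryTree ℕ+) : treeEnd wt t (Finsupp.single (inorder τ) 1) (preorderRight τ) =
      if t = τ.map wt then 1 else 0 := by
  induction τ generalizing t with
  | nil =>
    rcases t with _ | ⟨n, s, t⟩
    · simp [treeEnd, inorder, preorderRight, p_zero_nil, BinaryTree.map]
    · rw [if_neg (by simp [BinaryTree.map])]
      by_contra h
      obtain ⟨u, y, v, z, h, -⟩ := exists_of_treeEnd_node_apply_ne_zero wt h
      simp [inorder] at h
  | node y σ ρ hσ hρ =>
    rw [inorder] at hτ
    have hnσ : (inorder σ).Nodup := (List.nodup_append.1 hτ).1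
    have hnρ : (inorder ρ).Nodup := (List.nodup_cons.1 (List.nodup_append.1 hτ).2.1).2
    rcases t with _ | ⟨n, s, t⟩
    · rw [if_neg (by simp [BinaryTree.map]), treeEnd, p_single, if_neg, Finsupp.zero_apply]
      simp [inorder, weight]
    · have hP : ∀ a ∈ inorder σ, a ∉ inorder ρ := fun a ha hb =>
        (List.nodup_append.1 hτ).2.2 a ha a (by simp [hb]) rfl
      rw [inorder, preorderRight, treeEnd_node_apply_cons wt n s t hτ,
        shuffle_apply_of_separated (· ∈ inorder ρ)
          (fun u hu a ha => (perm_of_treeEnd_apply_ne_zero wt hu).mem_iff.1 ha)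
          (fun u hu a ha => hP a ((perm_of_treeEnd_apply_ne_zero wt hu).mem_iff.1 ha)),
        (filter_append_of_separated (· ∈ inorder ρ)
          (fun a ha => (preorderRight_perm ρ).mem_iff.1 ha)
          (fun a ha => hP a ((preorderRight_perm σ).mem_iff.1 ha))).1,
        (filter_append_of_separated (· ∈ inorder ρ)
          (fun a ha => (preorderRight_perm ρ).mem_iff.1 ha)
          (fun a ha => hP a ((preorderRight_perm σ).mem_iff.1 ha))).2,
        hσ hnσ, hρ hnρ]
      simp only [BinaryTree.map, node.injEq]
      split_ifs <;> simp_all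

/-- With infinitely many letters of every weight, each decorated tree underlies a tree with distinct
labels. -/
theorem exists_labelling (hX : ∀ n : ℕ+, {x : X | wt x = n}.Infinite) (t : BinaryTree ℕ+) :
    ∃ τ : BinaryTree X, τ.map wt = t ∧ (inorder τ).Nodup := by
  classical
  suffices ∀ F : Finset X, ∃ τ : BinaryTree X, τ.map wt = t ∧ (inorder τ).Nodup ∧
      ∀ x ∈ inorder τ, x ∉ F by
    obtain ⟨τ, h1, h2, -⟩ := this ∅
    exact ⟨τ, h1, h2⟩
  induction t with
  | nil => exact fun F => ⟨nil, rfl, by simp [inorder], by simp [inorder]⟩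
  | node n s t hs ht =>
    intro F
    obtain ⟨y, hy, hyF⟩ := (hX n).exists_notMem_finset F
    obtain ⟨σ, hσ, hσn, hσF⟩ := hs (insert y F)
    obtain ⟨ρ, hρ, hρn, hρF⟩ := ht (insert y F ∪ (inorder σ).toFinset)
    refine ⟨node y σ ρ, ?_, ?_, ?_⟩
    · rw [BinaryTree.map, hσ, hρ, show wt y = n from hy]
    · simp only [inorder]
      refine List.nodup_append.2 ⟨hσn, List.nodup_cons.2 ⟨fun h => hρF y h (by simp), hρn⟩, ?_⟩
      rintro a ha b hb rfl
      rcases List.mem_cons.1 hb with rfl | hb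
      · exact hσF a ha (by simp)
      · exact hρF a hb (by simp [ha])
    · intro x hx hxF
      simp only [inorder, List.mem_append, List.mem_cons] at hx
      rcases hx with hx | rfl | hx
      · exact hσF x hx (by simp [hxF])
      · exact hyF hxF
      · exact hρF x hx (by simp [hxF])

theorem linearCombination_treeEnd_apply (c : BinaryTree ℕ+ →₀ ℚ) (τ : BinaryTree X)
    (hτ : (inorder τ).Nodup) : Finsupp.linearCombination ℚ (treeEnd wt) c
      (Finsupp.single (inorder τ) 1) (preorderRight τ) = c (τ.map wt) := by
  classical
  induction c using Finsupp.induction_linear with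
  | zero => simp
  | add c d hc hd => simp [hc, hd]
  | single t q =>
    rw [Finsupp.linearCombination_single, LinearMap.smul_apply, Finsupp.smul_apply,
      treeEnd_inorder_preorderRight wt τ hτ, Finsupp.single_apply]
    simp

theorem linearIndependent_treeEnd (hX : ∀ n : ℕ+, {x : X | wt x = n}.Infinite) :
    LinearIndependent ℚ (treeEnd wt) := by
  rw [linearIndependent_iff]
  intro c hc
  ext t
  obtain ⟨τ, rfl, hτ⟩ := exists_labelling wt hX t
  rw [← linearCombination_treeEnd_apply wt c τ hτ, hc]
  rfl

theorem range_treeEvalLin_descd : LinearMap.range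
    (treeEvalLin (V := descdPlus wt) (descdPrec wt) (descdSucc wt) (letterGen wt)) = ⊤ := by
  set R := LinearMap.range
    (treeEvalLin (V := descdPlus wt) (descdPrec wt) (descdSucc wt) (letterGen wt)) with hR
  have hle : descdPlus wt ≤ R.map (descdPlus wt).subtype := by
    refine descdPlus_le wt (Submodule.map_subtype_le _ _) (fun n => ?_) ?_
    · refine ⟨letterGen wt n, ⟨Finsupp.single (node n nil nil) 1, ?_⟩, rfl⟩
      rw [treeEvalLin_single, one_smul, treeEval_leaf]
    · rintro _ ⟨x, hx, rfl⟩ _ ⟨y, hy, rfl⟩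
      have := mul_mem_range_treeEvalLin (letterGen wt) (isDendriform_descd wt) hx hy
      exact ⟨⟨_, this.1, rfl⟩, ⟨_, this.2, rfl⟩⟩
  rw [eq_top_iff]
  rintro x -
  obtain ⟨y, hy, hxy⟩ := hle x.2
  rwa [← Subtype.ext hxy]

/-- The evaluations of the nonempty decorated trees form a basis of the augmentation ideal. -/
noncomputable def treeBasis (hX : ∀ n : ℕ+, {x : X | wt x = n}.Infinite) :
    Module.Basis {t : BinaryTree ℕ+ // t ≠ nil} ℚ (descdPlus wt) :=
  Module.Basis.mk
    (v := fun t => treeEval (V := descdPlus wt) (descdPrec wt) (descdSucc wt) (letterGen wt) t)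
    (by
      refine LinearIndependent.of_comp (descdPlus wt).subtype ?_
      convert (linearIndependent_treeEnd wt hX).comp _ Subtype.val_injective using 1
      ext1 t
      exact coe_treeEval_of_ne_nil wt t.2)
    (by
      rw [← range_treeEvalLin_descd, treeEvalLin, Finsupp.range_linearCombination,
        Submodule.span_le]
      rintro _ ⟨t, rfl⟩
      by_cases ht : t = nil
      · subst ht
        simp
      · exact Submodule.subset_span ⟨⟨t, ht⟩, rfl⟩)

theorem isFreeDendriform_descd.{v, w0} {X : Type v} (wt : X → ℕ+)
    (hX : ∀ n : ℕ+, {x : X | wt x = n}.Infinite) :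
    IsFreeDendriform.{v, 0, w0} (descdPrec wt) (descdSucc wt) (letterGen wt) :=
  isFreeDendriform_of_basis (isDendriform_descd wt) (treeBasis wt hX) fun t => by
    rw [treeBasis, Module.Basis.mk_apply]

end Labelled

/-! ### Half-coproducts of graded permutations and half-shuffles of words -/

section Coproduct

variable {X : Type*} (wt : X → ℕ+)

open Classical in
theorem actWord_apply_ofFn (s : GradedPerm) (w : List X) (ζ : Fin s.1 → X) :
    actWord wt s w (List.ofFn ζ) =
      if w = List.ofFn (ζ ∘ s.2.1.symm) ∧ ∀ i, wt (ζ i) = s.2.2 i then 1 else 0 := by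
  obtain ⟨k, σ, d⟩ := s
  simp only at ζ ⊢
  by_cases h : k = w.length
  · subst h
    obtain ⟨ω, hω⟩ : ∃ ω : Fin w.length → X, ω = w.get := ⟨_, rfl⟩
    have hw : w = List.ofFn ω := by rw [hω, List.ofFn_get]
    have e : w = List.ofFn (ζ ∘ σ.symm) ↔ ω ∘ σ = ζ := by
      rw [← Equiv.eq_comp_symm, ← List.ofFn_inj, ← hw]
    simp only [e, actWord, Fin.cast_eq_self, dite_true, ← hω]
    by_cases hζ : ω ∘ σ = ζ
    · subst hζ
      simp only [Function.comp_apply, true_and]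
      split_ifs
      · exact Finsupp.single_eq_same
      · rfl
    · simp only [hζ, false_and, if_false]
      split_ifs
      · rw [Finsupp.single_eq_of_ne]
        exact fun h => hζ (List.ofFn_inj.1 h).symm
      · rfl
  · rw [actWord, dif_neg h, if_neg, Finsupp.zero_apply]
    rintro ⟨rfl, -⟩
    simp at h

theorem actWord_of_length_ne {s : GradedPerm} {w : List X} (h : s.1 ≠ w.length) :
    actWord wt s w = 0 := dif_neg h

open Classical in
theorem linearCombination_actWord_apply_ofFn (s : GradedPerm) (x : Sh X) (ζ : Fin s.1 → X) :
    Finsupp.linearCombination ℚ (actWord wt s) x (List.ofFn ζ) =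
      if ∀ i, wt (ζ i) = s.2.2 i then x (List.ofFn (ζ ∘ s.2.1.symm)) else 0 := by
  induction x using Sh.induction with
  | zero => simp
  | add x y hx hy => rw [map_add, Finsupp.add_apply, hx, hy]; split_ifs <;> simp
  | smul c x hx => rw [map_smul, Finsupp.smul_apply, hx]; split_ifs <;> simp
  | word w =>
    rw [Finsupp.linearCombination_single, one_smul, actWord_apply_ofFn, Finsupp.single_apply]
    by_cases h : ∀ i, wt (ζ i) = s.2.2 i <;> simp [h]

open Classical in
theorem filter_finRange_mem_range {m k : ℕ} {f : Fin m → Fin k} (hf : Function.Injective f) :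
    (List.finRange k).filter (fun i => i ∈ Set.range f) = List.ofFn (f ∘ Tuple.sort f) := by
  refine List.SortedLT.eq_of_mem_iff ?_ ?_ fun i => ?_
  · exact ((List.sortedLT_finRange k).pairwise.filter _).sortedLT
  · exact List.sortedLT_ofFn_iff.2
      ((Tuple.monotone_sort f).strictMono_of_injective (hf.comp (Tuple.sort f).injective))
  · simp only [List.mem_filter, List.mem_finRange, true_and, decide_eq_true_eq, List.mem_ofFn]
    exact ⟨fun ⟨j, hj⟩ => ⟨(Tuple.sort f).symm j, by simpa using hj⟩, fun ⟨j, hj⟩ => ⟨_, hj⟩⟩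

open Classical in
/-- Let `z` be obtained by permuting the letters of a word `w` by `σ`.  The subword of `w` on the
letters at a set of places of `z` is obtained by permuting these letters by the inverse of the
standardization of the corresponding part of `σ`. -/
theorem filter_ofFn_symm {m k : ℕ} (σ : Equiv.Perm (Fin k)) {ζ : Fin k → X}
    (hζ : Function.Injective ζ) {ι : Fin m → Fin k} (hι : Function.Injective ι) :
    (List.ofFn (ζ ∘ σ.symm)).filter (fun x => x ∈ List.ofFn (ζ ∘ ι)) =
      List.ofFn ((ζ ∘ ι) ∘ (standardize (σ ∘ ι)).symm) := by
  have e : ζ ∘ ι = (ζ ∘ σ.symm) ∘ (σ ∘ ι) := by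
    ext i; simp
  rw [List.ofFn_eq_map (f := ζ ∘ σ.symm), List.filter_map]
  have e2 : ((fun x => decide (x ∈ List.ofFn (ζ ∘ ι))) ∘ ζ ∘ σ.symm) =
      fun i => decide (i ∈ Set.range (σ ∘ ι)) := by
    ext i
    simp only [Function.comp_apply, List.mem_ofFn, Set.mem_range, hζ.eq_iff, Equiv.eq_symm_apply]
  rw [e2, filter_finRange_mem_range (σ.injective.comp hι), List.map_ofFn, e]
  rfl

/-- The first `j` letters of a word with the length of `s`. -/
def leftPart (s : GradedPerm) (j : Fin s.1) (ζ : Fin s.1 → X) (i : Fin j) : X :=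
  ζ (i.castLE j.isLt.le)

/-- What remains of a word with the length of `s` without its first `j` letters. -/
def rightPart (s : GradedPerm) (j : Fin s.1) (ζ : Fin s.1 → X) (i : Fin (s.1 - j)) : X :=
  ζ ⟨j + i, by omega⟩

theorem forall_fin_cut {s : GradedPerm} (j : Fin s.1) {Q : Fin s.1 → Prop} : (∀ i, Q i) ↔
    (∀ i : Fin j, Q (i.castLE j.isLt.le)) ∧ ∀ i : Fin (s.1 - j), Q ⟨j + i, by omega⟩ := by
  refine ⟨fun h => ⟨fun i => h _, fun i => h _⟩, fun h i => ?_⟩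
  by_cases hij : (i : ℕ) < j
  · exact h.1 ⟨i, hij⟩
  · have := h.2 ⟨i - j, by omega⟩
    convert this using 1
    ext
    simp
    omega

variable {s : GradedPerm} {j : Fin s.1} {ζ : Fin s.1 → X}

theorem not_mem_leftPart_of_mem_rightPart (hζ : Function.Injective ζ) {x : X}
    (hx : x ∈ List.ofFn (rightPart s j ζ)) : x ∉ List.ofFn (leftPart s j ζ) := by
  rw [List.mem_ofFn] at hx ⊢
  obtain ⟨i, rfl⟩ := hx
  rintro ⟨i', h⟩
  have := congrArg Fin.val (hζ h)
  simp at this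
  omega

theorem mem_leftPart_or_mem_rightPart (i : Fin s.1) :
    ζ i ∈ List.ofFn (leftPart s j ζ) ∨ ζ i ∈ List.ofFn (rightPart s j ζ) := by
  revert i
  rw [forall_fin_cut j]
  exact ⟨fun i => Or.inl (List.mem_ofFn.2 ⟨i, rfl⟩), fun i => Or.inr (List.mem_ofFn.2 ⟨i, rfl⟩)⟩

open Classical in
theorem filter_not_mem_leftPart (hζ : Function.Injective ζ) {w : List X}
    (hw : ∀ x ∈ w, x ∈ Set.range ζ) :
    w.filter (fun x => ¬ x ∈ List.ofFn (leftPart s j ζ)) =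
      w.filter (fun x => x ∈ List.ofFn (rightPart s j ζ)) := by
  refine List.filter_congr fun x hx => ?_
  obtain ⟨i, rfl⟩ := hw x hx
  have h1 := mem_leftPart_or_mem_rightPart (ζ := ζ) (j := j) i
  have h2 := not_mem_leftPart_of_mem_rightPart (j := j) hζ (x := ζ i)
  rw [decide_eq_decide]
  tauto

open Classical in
theorem filter_not_mem_rightPart (hζ : Function.Injective ζ) {w : List X}
    (hw : ∀ x ∈ w, x ∈ Set.range ζ) :
    w.filter (fun x => ¬ x ∈ List.ofFn (rightPart s j ζ)) =
      w.filter (fun x => x ∈ List.ofFn (leftPart s j ζ)) := by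
  refine List.filter_congr fun x hx => ?_
  obtain ⟨i, rfl⟩ := hw x hx
  have h1 := mem_leftPart_or_mem_rightPart (ζ := ζ) (j := j) i
  have h2 := not_mem_leftPart_of_mem_rightPart (j := j) hζ (x := ζ i)
  rw [decide_eq_decide]
  tauto

theorem mem_leftPart_iff_minInLeft (hζ : Function.Injective ζ) (h0 : 0 < s.1) :
    ζ (s.2.1.symm ⟨0, h0⟩) ∈ List.ofFn (leftPart s j ζ) ↔ MinInLeft s j := by
  rw [List.mem_ofFn]
  constructor
  · rintro ⟨i, hi⟩
    refine ⟨i.castLE j.isLt.le, i.isLt, ?_⟩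
    rw [show i.castLE j.isLt.le = s.2.1.symm ⟨0, h0⟩ from hζ hi, Equiv.apply_symm_apply]
  · rintro ⟨i, hij, hi⟩
    refine ⟨⟨i, hij⟩, congrArg ζ ?_⟩
    rw [Equiv.eq_symm_apply]
    exact Fin.ext hi

open Classical in
theorem actWord_cutLeft_mul_actWord_cutRight (hζ : Function.Injective ζ) (A B : List X) :
    actWord wt (cutLeft s j) A (List.ofFn (leftPart s j ζ)) *
      actWord wt (cutRight s j) B (List.ofFn (rightPart s j ζ)) =
    if (∀ i, wt (ζ i) = s.2.2 i) ∧
      (List.ofFn (ζ ∘ s.2.1.symm)).filter (fun x => x ∈ List.ofFn (leftPart s j ζ)) = A ∧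
      (List.ofFn (ζ ∘ s.2.1.symm)).filter (fun x => x ∈ List.ofFn (rightPart s j ζ)) = B
    then 1 else 0 := by
  have eL := actWord_apply_ofFn wt (cutLeft s j) A (leftPart s j ζ)
  have eR := actWord_apply_ofFn wt (cutRight s j) B (rightPart s j ζ)
  have fL : (List.ofFn (ζ ∘ s.2.1.symm)).filter (fun x => x ∈ List.ofFn (leftPart s j ζ)) =
      List.ofFn (leftPart s j ζ ∘ (cutLeft s j).2.1.symm) :=
    filter_ofFn_symm s.2.1 hζ (ι := fun i : Fin j => i.castLE j.isLt.le) (Fin.castLE_injective _)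
  have fR : (List.ofFn (ζ ∘ s.2.1.symm)).filter (fun x => x ∈ List.ofFn (rightPart s j ζ)) =
      List.ofFn (rightPart s j ζ ∘ (cutRight s j).2.1.symm) :=
    filter_ofFn_symm s.2.1 hζ (ι := fun i : Fin (s.1 - j) => ⟨j + i, by omega⟩) fun i i' h => by
      have := congrArg Fin.val h
      simp at this
      exact Fin.ext this
  have hd := forall_fin_cut j (Q := fun i => wt (ζ i) = s.2.2 i)
  refine (congrArg₂ (· * ·) eL eR).trans ?_
  rw [ite_zero_mul_ite_zero, mul_one]
  refine if_congr ?_ rfl rfl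
  constructor
  · rintro ⟨⟨h1, h2⟩, h3, h4⟩
    exact ⟨hd.2 ⟨h2, h4⟩, fL.trans h1.symm, fR.trans h3.symm⟩
  · rintro ⟨h, h1, h3⟩
    exact ⟨⟨h1.symm.trans fL, (hd.1 h).1⟩, h3.symm.trans fR, (hd.1 h).2⟩

theorem ofFn_comp_symm_cons (h0 : 0 < s.1) (ζ : Fin s.1 → X) :
    ∃ w, List.ofFn (ζ ∘ s.2.1.symm) = ζ (s.2.1.symm ⟨0, h0⟩) :: w := by
  obtain ⟨k, σ, d⟩ := s
  obtain _ | k := k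
  · simp at h0
  · exact ⟨_, List.ofFn_succ⟩

open Classical in
/-- For disjoint words `A` and `B`, a term of the value of a graded permutation at the half-shuffle
`A ≺ B` that has the letters of `A` in front of those of `B` corresponds to a cut of the graded
permutation for which the smallest letter is in the left part. -/
theorem linearCombination_actWord_precWord_left (hζ : Function.Injective ζ) {A B : List X}
    (hA : ∀ x ∈ A, x ∈ List.ofFn (leftPart s j ζ)) (hB : ∀ x ∈ B, x ∈ List.ofFn (rightPart s j ζ)) :
    Finsupp.linearCombination ℚ (actWord wt s) (precWord A B) (List.ofFn ζ) =
      if MinInLeft s j then actWord wt (cutLeft s j) A (List.ofFn (leftPart s j ζ)) *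
        actWord wt (cutRight s j) B (List.ofFn (rightPart s j ζ)) else 0 := by
  have h0 : 0 < s.1 := j.pos
  obtain ⟨w, hw⟩ := ofFn_comp_symm_cons h0 ζ
  have hmem : ∀ x ∈ List.ofFn (ζ ∘ s.2.1.symm), x ∈ Set.range ζ := by
    intro x hx
    obtain ⟨i, rfl⟩ := List.mem_ofFn.1 hx
    exact ⟨_, rfl⟩
  rw [linearCombination_actWord_apply_ofFn, actWord_cutLeft_mul_actWord_cutRight wt hζ,
    ← filter_not_mem_leftPart hζ hmem, hw,
    precWord_apply (· ∈ List.ofFn (leftPart s j ζ)) hA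
      (fun x hx => not_mem_leftPart_of_mem_rightPart hζ (hB x hx)),
    mem_leftPart_iff_minInLeft hζ h0]
  by_cases h1 : ∀ i, wt (ζ i) = s.2.2 i <;> by_cases h2 : MinInLeft s j <;> simp [h1, h2]

open Classical in
theorem linearCombination_actWord_precWord_right (hζ : Function.Injective ζ) {A B : List X}
    (hA : ∀ x ∈ A, x ∈ List.ofFn (leftPart s j ζ)) (hB : ∀ x ∈ B, x ∈ List.ofFn (rightPart s j ζ)) :
    Finsupp.linearCombination ℚ (actWord wt s) (precWord B A) (List.ofFn ζ) =
      if ¬ MinInLeft s j then actWord wt (cutLeft s j) A (List.ofFn (leftPart s j ζ)) *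
        actWord wt (cutRight s j) B (List.ofFn (rightPart s j ζ)) else 0 := by
  have h0 : 0 < s.1 := j.pos
  obtain ⟨w, hw⟩ := ofFn_comp_symm_cons h0 ζ
  have hmem : ∀ x ∈ List.ofFn (ζ ∘ s.2.1.symm), x ∈ Set.range ζ := by
    intro x hx
    obtain ⟨i, rfl⟩ := List.mem_ofFn.1 hx
    exact ⟨_, rfl⟩
  have hmin : ζ (s.2.1.symm ⟨0, h0⟩) ∈ List.ofFn (rightPart s j ζ) ↔ ¬ MinInLeft s j := by
    rw [← mem_leftPart_iff_minInLeft hζ h0]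
    have h1 := mem_leftPart_or_mem_rightPart (ζ := ζ) (j := j) (s.2.1.symm ⟨0, h0⟩)
    have h2 := not_mem_leftPart_of_mem_rightPart (j := j) hζ (x := ζ (s.2.1.symm ⟨0, h0⟩))
    tauto
  rw [linearCombination_actWord_apply_ofFn, actWord_cutLeft_mul_actWord_cutRight wt hζ,
    ← filter_not_mem_rightPart hζ hmem, hw,
    precWord_apply (· ∈ List.ofFn (rightPart s j ζ)) hB
      (fun x hx hx' => not_mem_leftPart_of_mem_rightPart hζ hx' (hA x hx)),
    hmin]
  by_cases h1 : ∀ i, wt (ζ i) = s.2.2 i <;> by_cases h2 : MinInLeft s j <;>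
    simp only [h1, h2, if_true, if_false, true_and, false_and, not_true, not_false_iff, implies_true]
  refine if_congr ⟨fun h => ⟨?_, ?_⟩, fun h => ⟨?_, ?_⟩⟩ rfl rfl
  exacts [by convert h.2, by convert h.1, by convert h.2, by convert h.1]

/-- The coefficient of the word `a` in the value at the word `A`, as a linear functional on the
space of graded permutations. -/
noncomputable def matrixCoeff (A a : List X) : GradedPermSpace →ₗ[ℚ] ℚ :=
  Finsupp.lapply a ∘ₗ LinearMap.applyₗ (Finsupp.single A 1) ∘ₗ Phi wt

@[simp] theorem matrixCoeff_single (A a : List X) (s : GradedPerm) :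
    matrixCoeff wt A a (Finsupp.single s 1) = actWord wt s A a := by
  simp [matrixCoeff, Phi]

theorem linearCombination_actWord_precWord_eq_zero {s : GradedPerm} {A B : List X}
    (h : s.1 ≠ A.length + B.length) :
    Finsupp.linearCombination ℚ (actWord wt s) (precWord A B) = 0 := by
  rw [Finsupp.linearCombination_apply]
  refine Finset.sum_eq_zero fun w hw => ?_
  have := (perm_of_precWord_apply_ne_zero (Finsupp.mem_support_iff.1 hw)).length_eq
  change _ • actWord wt s w = 0
  rw [actWord_of_length_ne, smul_zero]
  rwa [this, List.length_append]

/-- The adjunction between cuts of graded permutations and half-shuffles of words.  Here `c`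
selects a set of cuts, and `U` is the half-shuffle of `A` and `B` that corresponds to it. -/
theorem sum_actWord_cut {A B a b : List X} (U : Sh X) (c : ∀ s : GradedPerm, Fin s.1 → Prop)
    [∀ s j, Decidable (c s j)]    (s : GradedPerm) (hU : s.1 ≠ A.length + B.length →
      Finsupp.linearCombination ℚ (actWord wt s) U = 0)
    (hc : ∀ (j : Fin s.1) (ζ : Fin s.1 → X), Function.Injective ζ →
      List.ofFn (leftPart s j ζ) = a → List.ofFn (rightPart s j ζ) = b →
      Finsupp.linearCombination ℚ (actWord wt s) U (List.ofFn ζ) =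
        if c s j then actWord wt (cutLeft s j) A a * actWord wt (cutRight s j) B b else 0)
    (hn : (a ++ b).Nodup) (ha : a.length = A.length) (hb : b.length = B.length)
    (ha0 : a ≠ []) (hb0 : b ≠ []) :
    LinearMap.mul' ℚ ℚ (TensorProduct.map (matrixCoeff wt A a) (matrixCoeff wt B b)
      (∑ j : Fin s.1, if 0 < (j : ℕ) ∧ c s j then
        (Finsupp.single (cutLeft s j) 1 : GradedPermSpace) ⊗ₜ[ℚ]
          (Finsupp.single (cutRight s j) 1 : GradedPermSpace) else 0)) =
      Phi wt (Finsupp.single s 1) U (a ++ b) := by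
  have hΦ : Phi wt (Finsupp.single s 1) = Finsupp.linearCombination ℚ (actWord wt s) := by
    simp [Phi]
  have hterm : ∀ j : Fin s.1, LinearMap.mul' ℚ ℚ
      (TensorProduct.map (matrixCoeff wt A a) (matrixCoeff wt B b)
        (if 0 < (j : ℕ) ∧ c s j then
          (Finsupp.single (cutLeft s j) 1 : GradedPermSpace) ⊗ₜ[ℚ]
            (Finsupp.single (cutRight s j) 1 : GradedPermSpace) else 0)) =
      if 0 < (j : ℕ) ∧ c s j then
        actWord wt (cutLeft s j) A a * actWord wt (cutRight s j) B b else 0 := by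
    intro j
    split_ifs
    · rw [TensorProduct.map_tmul, LinearMap.mul'_apply, matrixCoeff_single, matrixCoeff_single]
    · simp
  rw [map_sum, map_sum, Finset.sum_congr rfl fun j _ => hterm j, hΦ]
  by_cases hs : s.1 = A.length + B.length
  · have hpos : 0 < b.length := List.length_pos_iff.2 hb0
    have hpos' : 0 < a.length := List.length_pos_iff.2 ha0
    set j0 : Fin s.1 := ⟨a.length, by omega⟩ with hj0
    set ζ : Fin s.1 → X := fun i => (a ++ b)[(i : ℕ)]'(by simp; omega) with hζ
    have hζi : Function.Injective ζ := fun i i' h => Fin.ext ((hn.getElem_inj_iff).1 h)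
    have hab : List.ofFn ζ = a ++ b := by
      refine List.ext_getElem (by simp; omega) fun i h1 h2 => ?_
      simp [hζ]
    have hL : List.ofFn (leftPart s j0 ζ) = a := by
      refine List.ext_getElem (by simp [hj0]) fun i h1 h2 => ?_
      simp [hζ, leftPart, List.getElem_append, h2]
    have hR : List.ofFn (rightPart s j0 ζ) = b := by
      refine List.ext_getElem (by simp [hj0]; omega) fun i h1 h2 => ?_
      simp [hζ, rightPart, hj0]
    rw [← hab, hc j0 ζ hζi hL hR, Finset.sum_eq_single j0]
    · simp [hj0, hpos']
    · intro j _ hj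
      rw [actWord_of_length_ne (w := A), Finsupp.zero_apply, zero_mul, ite_self]
      intro h
      exact hj (Fin.ext (h.trans ha.symm))
    · simp
  · rw [hU hs]
    refine Finset.sum_eq_zero fun j _ => ?_
    by_cases h1 : (j : ℕ) = A.length
    · rw [actWord_of_length_ne (w := B), Finsupp.zero_apply, mul_zero, ite_self]
      intro h2
      have := j.isLt
      have h2 : s.1 - j = B.length := h2
      omega
    · rw [actWord_of_length_ne (w := A), Finsupp.zero_apply, zero_mul, ite_self]
      exact h1

open Classical in
/-- A dendriform primitive element sends the half-shuffles of `A` and `B` to combinations of words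
in which a nonempty word in the letters of `A` is never followed by a nonempty word in the letters
of `B`. -/
theorem Phi_precWord_apply_eq_zero {f : GradedPermSpace} (hf : f ∈ primDend)
    {A B a b : List X} (hn : (a ++ b).Nodup) (hA : a.Perm A) (hB : b.Perm B)
    (ha0 : a ≠ []) (hb0 : b ≠ []) :
    Phi wt f (precWord A B) (a ++ b) = 0 ∧ Phi wt f (precWord B A) (a ++ b) = 0 := by
  have left : LinearMap.mul' ℚ ℚ ∘ₗ
      TensorProduct.map (matrixCoeff wt A a) (matrixCoeff wt B b) ∘ₗ deltaPrec =
      Finsupp.lapply (a ++ b) ∘ₗ LinearMap.applyₗ (precWord A B) ∘ₗ Phi wt := by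
    refine Finsupp.lhom_ext' fun s => LinearMap.ext_ring ?_
    simp only [LinearMap.comp_apply, Finsupp.lsingle_apply, Finsupp.lapply_apply,
      LinearMap.applyₗ_apply_apply, deltaPrec, Finsupp.linearCombination_single, one_smul]
    refine sum_actWord_cut wt _ MinInLeft s (linearCombination_actWord_precWord_eq_zero wt)
      (fun j ζ hζ hL hR => ?_) hn hA.length_eq hB.length_eq ha0 hb0
    subst hL hR
    exact linearCombination_actWord_precWord_left wt hζ (fun x hx => hA.mem_iff.2 hx)
      (fun x hx => hB.mem_iff.2 hx)
  have right : LinearMap.mul' ℚ ℚ ∘ₗ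
      TensorProduct.map (matrixCoeff wt A a) (matrixCoeff wt B b) ∘ₗ deltaSucc =
      Finsupp.lapply (a ++ b) ∘ₗ LinearMap.applyₗ (precWord B A) ∘ₗ Phi wt := by
    refine Finsupp.lhom_ext' fun s => LinearMap.ext_ring ?_
    simp only [LinearMap.comp_apply, Finsupp.lsingle_apply, Finsupp.lapply_apply,
      LinearMap.applyₗ_apply_apply, deltaSucc, Finsupp.linearCombination_single, one_smul]
    refine sum_actWord_cut wt _ (fun s j => ¬ MinInLeft s j) s
      (fun h => linearCombination_actWord_precWord_eq_zero wt (by rwa [add_comm]))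
      (fun j ζ hζ hL hR => ?_) hn hA.length_eq hB.length_eq ha0 hb0
    subst hL hR
    exact linearCombination_actWord_precWord_right wt hζ (fun x hx => hA.mem_iff.2 hx)
      (fun x hx => hB.mem_iff.2 hx)
  have hprec : deltaPrec f = 0 := hf.1.2
  have hsucc : deltaSucc f = 0 := hf.2
  constructor
  · have := LinearMap.congr_fun left f
    simpa [hprec] using this.symm
  · have := LinearMap.congr_fun right f
    simpa [hsucc] using this.symm

end Coproduct

/-! ### The right subtree of the leftmost node -/

section Leftmost

/-- The number of nodes of the right subtree of the leftmost node of a tree. -/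
def leftmostRight {ι : Type*} : BinaryTree ι → ℕ
  | nil => 0
  | node _ nil t => t.numNodes
  | node _ (node b s s') _ => leftmostRight (node b s s')

theorem leftmostRight_node {ι : Type*} (n : ι) {s : BinaryTree ι} (hs : s ≠ nil)
    (t : BinaryTree ι) : leftmostRight (node n s t) = leftmostRight s := by
  cases s with
  | nil => exact absurd rfl hs
  | node => rw [leftmostRight]

theorem takeWhile_append_cons {α : Type*} {p q : α → Bool} {u : List α} {y : α} (x : List α)
    (hpq : ∀ a ∈ u, p a = q a) (hy : p y = false) :
    (u ++ y :: x).takeWhile p = u.takeWhile q := by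
  induction u with
  | nil => simp [hy]
  | cons a u ih =>
    rw [List.cons_append, List.takeWhile_cons, List.takeWhile_cons, hpq a (by simp),
      ih fun b hb => hpq b (by simp [hb])]

variable {X : Type*} (wt : X → ℕ+)

theorem numNodes_eq_length {t : BinaryTree ℕ+} {w z : List X}
    (h : treeEnd wt t (Finsupp.single w 1) z ≠ 0) : t.numNodes = w.length := by
  induction t generalizing w z with
  | nil =>
    rcases w with _ | ⟨a, w⟩
    · rfl
    · rw [treeEnd, p_zero_cons] at h
      exact absurd rfl h
  | node n s t hs ht =>
    obtain ⟨u, y, v, z', rfl, rfl, -, h'⟩ := exists_of_treeEnd_node_apply_ne_zero wt h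
    obtain ⟨z1, z2, h1, h2, -⟩ := exists_of_shuffle_apply_ne_zero h'
    rw [numNodes, hs h2, ht h1]
    simp
    omega

theorem eq_nil_iff_of_treeEnd_apply_ne_zero {t : BinaryTree ℕ+} {w z : List X}
    (h : treeEnd wt t (Finsupp.single w 1) z ≠ 0) : t = nil ↔ w = [] := by
  rw [← List.length_eq_zero_iff, ← numNodes_eq_length wt h]
  cases t <;> simp

open Classical in
/-- Suppose that a tree sends a word with first letter `v` to a combination in which a word
`a v b` occurs.  The first letter of the argument is the leftmost node, and the letters of its right
subtree are the following letters up to the first one that occurs in `a`: all ancestors of the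
leftmost node are in `a`, and no node of its right subtree is. -/
theorem leftmostRight_eq_length_takeWhile {t : BinaryTree ℕ+} {v : X} {w a b : List X}
    (hn : (v :: w).Nodup) (h : treeEnd wt t (Finsupp.single (v :: w) 1) (a ++ v :: b) ≠ 0) :
    leftmostRight t = (w.takeWhile fun x => x ∉ a).length ∧
      (a ≠ [] → ∃ n s s', s ≠ nil ∧ t = node n s s') := by
  induction t generalizing v w a b with
  | nil =>
    rw [treeEnd, p_zero_cons] at h
    exact absurd rfl h
  | node n s t hs ht =>
    have hz : (a ++ v :: b).Nodup := (perm_of_treeEnd_apply_ne_zero wt h).nodup_iff.2 hn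
    obtain ⟨u, y, x, z, hw, hz', -, h'⟩ := exists_of_treeEnd_node_apply_ne_zero wt h
    obtain ⟨z1, z2, h1, h2, -⟩ := exists_of_shuffle_apply_ne_zero h'
    rcases u with _ | ⟨v', u⟩
    · obtain ⟨rfl, rfl⟩ : v = y ∧ w = x := by simpa using hw
      obtain rfl : a = [] := by
        rcases a with _ | ⟨a0, a⟩
        · rfl
        · obtain ⟨rfl, -⟩ : a0 = v ∧ _ := by simpa using hz'
          simp at hz
      obtain rfl := (eq_nil_iff_of_treeEnd_apply_ne_zero wt h2).2 rfl
      refine ⟨?_, fun h => absurd rfl h⟩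
      rw [leftmostRight, numNodes_eq_length wt h1, List.takeWhile_eq_self_iff.2]
      simp
    · obtain ⟨rfl, rfl⟩ : v = v' ∧ w = u ++ y :: x := by simpa using hw
      have hs0 : s ≠ nil := by
        rw [Ne, eq_nil_iff_of_treeEnd_apply_ne_zero wt h2]
        simp
      refine ⟨?_, fun _ => ⟨n, s, t, hs0, rfl⟩⟩
      rcases a with _ | ⟨a0, a⟩
      · obtain ⟨rfl, -⟩ : v = y ∧ _ := by simpa using hz'
        simp at hn
      obtain ⟨rfl, rfl⟩ : a0 = y ∧ a ++ v :: b = z := by simpa using hz'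
      have hn' : ((v :: u) ++ a0 :: x).Nodup := hn
      have hux : ∀ c ∈ v :: u, c ∉ x ∧ c ≠ a0 := fun c hc =>
        ⟨fun hcx => (List.nodup_append.1 hn').2.2 c hc c (by simp [hcx]) rfl,
          (List.nodup_append.1 hn').2.2 c hc a0 (by simp)⟩
      rw [shuffle_apply_of_separated (· ∈ x)
        (fun u hu a ha => (perm_of_treeEnd_apply_ne_zero wt hu).mem_iff.1 ha)
        (fun u hu a ha => (hux a ((perm_of_treeEnd_apply_ne_zero wt hu).mem_iff.1 ha)).1)] at h'
      have h3 := right_ne_zero_of_mul h'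
      rw [List.filter_append, List.filter_cons_of_pos (by simpa using (hux v (by simp)).1)] at h3
      rw [leftmostRight_node n hs0, (hs (List.nodup_append.1 hn').1 h3).1]
      refine congrArg List.length (takeWhile_append_cons x (fun c hc => ?_) (by simp)).symm
      have := hux c (by simp [hc])
      simp [this.1, this.2]

open Classical in
/-- In a shuffle of `c` and `e`, a word that is not `c e` has a letter of `e` after fewer than
`c.length` letters. -/
theorem length_takeWhile_lt_or_eq_append {a c e w : List X} (he : ∀ x ∈ e, x ∈ a)
    (h : shuffleWord c e w ≠ 0) :
    (w.takeWhile fun x => x ∉ a).length < c.length ∨ w = c ++ e := by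
  induction c generalizing w with
  | nil =>
    rw [shuffleWord_nil_left, Finsupp.single_apply_ne_zero] at h
    exact Or.inr h.1
  | cons x c ih =>
    rcases e with _ | ⟨y, e⟩
    · rw [shuffleWord_nil_right, Finsupp.single_apply_ne_zero] at h
      exact Or.inr (by simp [h.1])
    rw [shuffleWord_cons_cons, Finsupp.add_apply] at h
    by_cases h1 : consMap x (shuffleWord c (y :: e)) w = 0
    · rw [h1, zero_add] at h
      obtain ⟨w, rfl, -⟩ := exists_of_consMap_apply_ne_zero h
      left
      simp [he y (by simp)]
    · obtain ⟨w, rfl, h2⟩ := exists_of_consMap_apply_ne_zero h1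
      rcases ih h2 with h3 | rfl
      · left
        rw [List.takeWhile_cons]
        split_ifs
        · simpa using h3
        · simp
      · right; rfl

/-- If the root is not the leftmost node `v` of a labelled tree, then `v` and its right subtree come
first in the infix order and last in `preorderRight`. -/
theorem exists_leftmost_decomposition (σ : BinaryTree X) (hσ : σ ≠ nil) (y : X)
    (ρ : BinaryTree X) : ∃ v c e a b, inorder (node y σ ρ) = v :: (c ++ e) ∧
      preorderRight (node y σ ρ) = a ++ v :: b ∧ a.Perm e ∧ b.Perm c ∧ e ≠ [] := by
  induction σ generalizing y ρ with
  | nil => exact absurd rfl hσ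
  | node y' σ' ρ' ih _ =>
    by_cases hσ' : σ' = nil
    · subst hσ'
      exact ⟨y', inorder ρ', y :: inorder ρ, y :: preorderRight ρ, preorderRight ρ',
        by simp [inorder], by simp [preorderRight], (preorderRight_perm ρ).cons y,
        preorderRight_perm ρ', by simp⟩
    · obtain ⟨v, c, e, a, b, h1, h2, h3, h4, -⟩ := ih hσ' y' ρ'
      refine ⟨v, c, e ++ y :: inorder ρ, y :: (preorderRight ρ ++ a), b, ?_, ?_, ?_, h4, by simp⟩
      · rw [inorder, h1]; simp
      · rw [preorderRight, h2]; simp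
      · exact ((List.perm_append_comm.trans (h3.append (preorderRight_perm ρ))).cons y).trans
          List.perm_middle.symm

end Leftmost

/-! ### Dendriform primitive elements -/

section Primitive

variable {X : Type*} (wt : X → ℕ+)

theorem linearCombination_treeEnd_eq (c : BinaryTree ℕ+ →₀ ℚ) :
    Finsupp.linearCombination ℚ (treeEnd wt) c = c nil • p wt 0 +
      (treeEvalLin (V := descdPlus wt) (descdPrec wt) (descdSucc wt) (letterGen wt) c : EndSh X) := by
  induction c using Finsupp.induction_linear with
  | zero => simp
  | add c d hc hd =>
    rw [map_add, hc, hd, Finsupp.add_apply, map_add, Submodule.coe_add, add_smul]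
    abel
  | single t q =>
    rw [Finsupp.linearCombination_single, treeEvalLin_single, treeEnd_eq_add_treeEval,
      Submodule.coe_smul, smul_add, smul_smul]
    congr 2
    by_cases ht : t = nil
    · simp [ht]
    · simp [Finsupp.single_eq_of_ne (Ne.symm ht)]

theorem exists_linearCombination_treeEnd {F : EndSh X} (hF : F ∈ descdPlus wt) :
    ∃ c : BinaryTree ℕ+ →₀ ℚ, c nil = 0 ∧ Finsupp.linearCombination ℚ (treeEnd wt) c = F := by
  obtain ⟨c, hc⟩ := LinearMap.range_eq_top.1 (range_treeEvalLin_descd wt) ⟨F, hF⟩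
  refine ⟨c - Finsupp.single nil (c nil), by simp, ?_⟩
  rw [map_sub, linearCombination_treeEnd_eq, hc, Finsupp.linearCombination_single, treeEnd]
  simp

theorem Phi_mem_descdPlus {f : GradedPermSpace} (hf : f ∈ augIdeal) (hd : Phi wt f ∈ descd wt) :
    Phi wt f ∈ descdPlus wt := by
  refine (mem_descdPlus wt).2 ⟨hd, ?_⟩
  rw [Phi, Finsupp.linearCombination_apply, Finsupp.sum, LinearMap.sum_apply]
  refine Finset.sum_eq_zero fun s hs => ?_
  have h0 : 0 < s.1 := (Finsupp.mem_supported ℚ f).1 hf hs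
  rw [LinearMap.smul_apply, Finsupp.linearCombination_single,
    actWord_of_length_ne wt (by simpa using h0.ne'), smul_zero, smul_zero]

variable {c : BinaryTree ℕ+ →₀ ℚ} {f : GradedPermSpace}

theorem coeff_eq_zero_of_left_eq_nil (hX : ∀ n : ℕ+, {x : X | wt x = n}.Infinite)
    (hf : f ∈ primDend) (hc : Finsupp.linearCombination ℚ (treeEnd wt) c = Phi wt f)
    (n : ℕ+) {t : BinaryTree ℕ+} (ht : t ≠ nil) : c (node n nil t) = 0 := by
  obtain ⟨τ, hτ, hn⟩ := exists_labelling wt hX (node n nil t)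
  rw [← hτ, ← linearCombination_treeEnd_apply wt c τ hn, hc]
  rcases τ with _ | ⟨y, σ, ρ⟩
  · simp [BinaryTree.map] at hτ
  rcases σ with _ | ⟨_, _, _⟩
  swap
  · simp [BinaryTree.map] at hτ
  have hρ : preorderRight ρ ≠ [] := by
    rcases ρ with _ | ⟨_, _, _⟩
    · simp [BinaryTree.map] at hτ
      exact absurd hτ.2.symm ht
    · simp [preorderRight]
  have hz : preorderRight (node y nil ρ) = [y] ++ preorderRight ρ := by
    simp [preorderRight]
  have hw : (Finsupp.single (inorder (node y nil ρ)) 1 : Sh X) = precWord [y] (inorder ρ) := by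
    simp [inorder, precWord_cons]
  rw [hw, hz]
  refine (Phi_precWord_apply_eq_zero wt hf ?_ (List.Perm.refl _) (preorderRight_perm ρ)
    (by simp) hρ).1
  rw [← hz]
  exact (preorderRight_perm _).nodup_iff.2 hn

/-- The coefficient of a tree whose root is not its leftmost node vanishes, by induction on the size
of the right subtree of the leftmost node `v`.  The condition that corresponds to cutting off `v`
with its right subtree involves, apart from this tree, only trees with a smaller such subtree. -/
theorem coeff_eq_zero_of_left_ne_nil (hX : ∀ n : ℕ+, {x : X | wt x = n}.Infinite)
    (hf : f ∈ primDend) (hc : Finsupp.linearCombination ℚ (treeEnd wt) c = Phi wt f)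
    (n : ℕ+) {s : BinaryTree ℕ+} (hs : s ≠ nil) (t : BinaryTree ℕ+) : c (node n s t) = 0 := by
  classical
  induction hm : leftmostRight (node n s t) using Nat.strong_induction_on generalizing n s t with
  | _ m ih =>
  obtain ⟨τ, hτ, hn⟩ := exists_labelling wt hX (node n s t)
  have hone := treeEnd_inorder_preorderRight wt τ hn (node n s t)
  rw [if_pos hτ.symm] at hone
  have hcoeff := linearCombination_treeEnd_apply wt c τ hn
  rw [hτ] at hcoeff
  rw [← hcoeff, hc]
  have hz := (preorderRight_perm τ).nodup_iff.2 hn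
  rcases τ with _ | ⟨y, σ, ρ⟩
  · simp [BinaryTree.map] at hτ
  have hσ : σ ≠ nil := by
    rintro rfl
    simp [BinaryTree.map] at hτ
    exact hs hτ.2.1.symm
  obtain ⟨v, d, e, a, b, hin, hpre, hae, hbd, he⟩ := exists_leftmost_decomposition σ hσ y ρ
  rw [hin, hpre] at hone ⊢
  rw [hin] at hn
  rw [hpre] at hz
  have ha : a ≠ [] := by
    rintro rfl
    exact he (List.nil_perm.1 hae)
  have hda : ∀ x ∈ d, x ∉ a := fun x hx hxa =>
    (List.nodup_append.1 (List.nodup_cons.1 hn).2).2.2 x hx x (hae.mem_iff.1 hxa) rfl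
  have hm' : m = d.length := by
    rw [← hm, (leftmostRight_eq_length_takeWhile wt hn (by rw [hone]; exact one_ne_zero)).1]
    obtain ⟨e0, e1, rfl⟩ := List.exists_cons_of_ne_nil he
    rw [takeWhile_append_cons (q := fun _ => true) e1 (by simpa using hda)
      (by simpa using hae.mem_iff.2 (by simp)), List.takeWhile_eq_self_iff.2 (by simp)]
  have hzero := (Phi_precWord_apply_eq_zero wt hf hz hae (hbd.cons v) ha (by simp)).2
  -- The half-shuffle `v d ≺ e` contains the word `v d e` once.
  have hsum : Phi wt f (precWord (v :: d) e) (a ++ v :: b) =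
      Phi wt f (Finsupp.single (v :: (d ++ e)) 1) (a ++ v :: b) := by
    have hexp : shuffleWord d e = (shuffleWord d e).sum fun w q => q • Finsupp.single w 1 := by
      conv_lhs => rw [← Finsupp.sum_single (shuffleWord d e)]
      simp
    rw [precWord_cons, hexp, Finsupp.sum, map_sum, map_sum, Finsupp.finsetSum_apply,
      Finset.sum_eq_single (d ++ e)]
    · rw [map_smul, map_smul, Finsupp.smul_apply, consMap_single,
        shuffleWord_apply (· ∉ a) hda (fun x hx => by simpa using hae.mem_iff.2 hx),
        if_pos (filter_append_of_separated (· ∉ a) hda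
          (fun x hx => by simpa using hae.mem_iff.2 hx)), one_smul]
    · intro w hw hne
      rw [map_smul, map_smul, Finsupp.smul_apply, consMap_single, ← hc,
        Finsupp.linearCombination_apply, Finsupp.sum, LinearMap.sum_apply, Finsupp.finsetSum_apply,
        Finset.sum_eq_zero, smul_zero]
      intro t' _
      rw [LinearMap.smul_apply, Finsupp.smul_apply, smul_eq_mul]
      by_contra hne'
      have hw := Finsupp.mem_support_iff.1 hw
      have hwn : (v :: w).Nodup :=
        ((perm_of_shuffleWord_apply_ne_zero hw).cons v).nodup_iff.2 hn
      obtain ⟨h1, h2⟩ := leftmostRight_eq_length_takeWhile wt hwn (right_ne_zero_of_mul hne')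
      obtain ⟨n', s', t', hs', rfl⟩ := h2 ha
      rcases length_takeWhile_lt_or_eq_append (fun x hx => hae.mem_iff.2 hx) hw with h3 | h3
      · exact left_ne_zero_of_mul hne' (ih _ (by rw [hm', h1]; exact h3) n' hs' t' rfl)
      · exact hne h3
    · intro h
      rw [Finsupp.notMem_support_iff.1 h, zero_smul, map_zero, map_zero, Finsupp.zero_apply]
  rw [← hsum, hzero]

theorem treeEnd_leaf (n : ℕ+) : treeEnd wt (node n nil nil) = letterProj wt n := by
  rw [← coe_treeEval_of_ne_nil wt (by simp), treeEval_leaf]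
  rfl

/-- The graded permutation of one letter of weight `n` acts as the projection `π n`. -/
theorem Phi_one_letter (n : ℕ+) : Phi wt (Finsupp.single ⟨1, 1, fun _ => n⟩ 1) =
    letterProj wt n := by
  refine EndSh.ext_word fun w => ?_
  rw [letterProj_single, Phi, Finsupp.linearCombination_single, one_smul,
    Finsupp.linearCombination_single, one_smul]
  rcases w with _ | ⟨x, _ | ⟨x', w⟩⟩
  · simp [actWord]
  · simp [actWord]
  · rw [actWord_of_length_ne _ (by simp), if_neg (by simp)]

theorem one_letter_mem_primDend (n : ℕ+) :
    (Finsupp.single ⟨1, 1, fun _ => n⟩ 1 : GradedPermSpace) ∈ primDend := by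
  refine ⟨⟨Finsupp.single_mem_supported ℚ _ (by simp), ?_⟩, ?_⟩
  · simp [deltaPrec]
  · simp [deltaSucc]

theorem primDescd_eq_span (hX : ∀ n : ℕ+, {x : X | wt x = n}.Infinite) :
    primDescd wt = Submodule.span ℚ (Set.range (letterProj wt)) := by
  refine le_antisymm ?_ (Submodule.span_le.2 ?_)
  · rintro _ ⟨hd, f, hf, rfl⟩
    obtain ⟨c, hc0, hc⟩ := exists_linearCombination_treeEnd wt (Phi_mem_descdPlus wt hf.1.1 hd)
    rw [← hc, Finsupp.linearCombination_apply]
    refine Submodule.sum_mem _ fun t ht => Submodule.smul_mem _ _ ?_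
    have ht := Finsupp.mem_support_iff.1 ht
    rcases t with _ | ⟨n, s, t⟩
    · exact absurd hc0 ht
    by_cases hs : s = nil
    · subst hs
      by_cases ht' : t = nil
      · subst ht'
        rw [treeEnd_leaf]
        exact Submodule.subset_span ⟨n, rfl⟩
      · exact absurd (coeff_eq_zero_of_left_eq_nil wt hX hf hc n ht') ht
    · exact absurd (coeff_eq_zero_of_left_ne_nil wt hX hf hc n hs t) ht
  · rintro _ ⟨n, rfl⟩
    exact ⟨(letterProj_mem_descdPlus wt n).1, _, one_letter_mem_primDend n, Phi_one_letter wt n⟩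

theorem linearIndependent_letterProj (hX : ∀ n : ℕ+, {x : X | wt x = n}.Infinite) :
    LinearIndependent ℚ (letterProj wt) := by
  convert (linearIndependent_treeEnd wt hX).comp (fun n : ℕ+ => node n nil nil)
    (fun m n h => by simpa using h) using 1
  ext1 n
  exact (treeEnd_leaf wt n).symm

end Primitive

end ShuffleDescent

theorem mainTheorem2 {X : Type u} (wt : X → ℕ+)
    (hX : ∀ n : ℕ+, {x : X | wt x = n}.Infinite) :
    (∃ b : Module.Basis ℕ+ ℚ (ShuffleDescent.primDescd wt),
      ∀ n, (b n : ShuffleDescent.EndSh X) = ShuffleDescent.letterProj wt n) ∧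
    (Disjoint (Submodule.span ℚ {ShuffleDescent.p wt 0}) (ShuffleDescent.descdPlus wt) ∧
      Submodule.span ℚ {ShuffleDescent.p wt 0} ⊔ ShuffleDescent.descdPlus wt =
        ShuffleDescent.descd wt) ∧
    ∃ hπ : ∀ n, ShuffleDescent.letterProj wt n ∈ ShuffleDescent.descdPlus wt,
      ShuffleDescent.IsFreeDendriform.{u, 0, w}
        (ShuffleDescent.descdPrec wt) (ShuffleDescent.descdSucc wt)
        (fun n : ℕ+ => (⟨ShuffleDescent.letterProj wt n, hπ n⟩ : ShuffleDescent.descdPlus wt)) := by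
  refine ⟨⟨(Module.Basis.span (ShuffleDescent.linearIndependent_letterProj wt hX)).map
    (LinearEquiv.ofEq _ _ (ShuffleDescent.primDescd_eq_span wt hX).symm), fun n => ?_⟩,
    ShuffleDescent.descd_eq_span_sup_descdPlus wt,
    ShuffleDescent.letterProj_mem_descdPlus wt, ShuffleDescent.isFreeDendriform_descd wt hX⟩
  rw [Module.Basis.map_apply, LinearEquiv.coe_ofEq_apply, Module.Basis.span_apply]
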